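/- Let $k$ be a field of characteristic $\neq 2$, let $l\ge 1$, and let $n=2l$ or $n=2l+1$. Index rows and columns by $1,\dots,l,-1,\dots,-l$ if $n=2l$ and by $0,1,\dots,l,-1,\dots,-l$ if $n=2l+1$. Let $$\beta=\begin{pmatrix}0&I_l\\ I_l&0\end{pmatrix}\ (n=2l),\qquad \beta=\begin{pmatrix}2&0&0\\0&0&I_l\\0&I_l&0\end{pmatrix}\ (n=2l+1),$$ and $\mathrm O(n,k)=\{g\in \mathrm{GL}(n,k)\mid {}^tg\beta g=\beta\}$, $\mathrm{SO}(n,k)=\{g\in\mathrm O(n,k)\mid\det g=1\}$. For $u\in k^n$ with $\beta(u,u)={}^tu\beta u\ne0$ let $\rho_u(v)=v-2\frac{\beta(u,v)}{\beta(u,u)}u$. The *spinor norm* of $g\in\mathrm O(n,k)$ is $\Theta(g)=\prod_{i}\frac12\beta(u_i,u_i)\cdot k^{\times2}\in k^\times/k^{\times 2}$, where $g=\rho_{u_1}\cdots\rho_{u_m}$. *Elementary matrices.* For $1\le i,j\le l$ and $t\in k$ put $x_{i,j}(t)=I+t(e_{i,j}-e_{-j,-i})$ for $i\ne j$; $x_{i,-j}(t)=I+t(e_{i,-j}-e_{j,-i})$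 and $x_{-i,j}(t)=I+t(e_{-i,j}-e_{-j,i})$ for $i<j$; $w_l=I-e_{l,l}-e_{-l,-l}-e_{l,-l}-e_{-l,l}$; and, for $n=2l+1$ only, $x_{i,0}(t)=I+t(2e_{i,0}-e_{0,-i})-t^2e_{i,-i}$ and $x_{0,i}(t)=I+t(-2e_{-i,0}+e_{0,i})-t^2e_{-i,i}$. Left (right) multiplication by such matrices gives the row (column) operations of type 1 ($x_{i,j}$), type 2 ($x_{i,-j}$), type 3 ($x_{-i,j}$) and type 4 ($x_{i,0}$, $x_{0,i}$). *Elimination algorithm.* In a matrix let $A$ be the block with rows and columns $1,\dots,l$; $B$ the block with rows $1,\dots,l$ and columns $-1,\dots,-l$; $C$ the block with rows $-1,\dots,-l$ and columns $1,\dots,l$; and, for $n=2l+1$, let $X$ be row $0$, columns $1,\dots,l$, and $E$ column $0$, rows $1,\dots,l$. To *interchange* $i$ and $-i$ means to multiply on the left by $I-e_{i,i}-e_{-i,-i}-e_{i,-i}-e_{-i,i}$ if $n=2l$, and by $I-2e_{0,0}-e_{i,i}-e_{-i,-i}-e_{i,-i}-e_{-i,i}$ if $n=2l+1$. Starting from $g\in\mathrm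 O(n,k)$: 1. By row and column operations of type 1 bring $A$ to the form (a) $\mathrm{diag}(1,\dots,1,\lambda)$ with $\lambda\ne0$, or (b) $\mathrm{diag}(1,\dots,1,0,\dots,0)$ with $m<l$ ones. 2. If $n=2l+1$, by row and column operations of type 4 make $X=0=E$ in case (a), and make the first $m$ entries of $X$ and of $E$ zero in case (b), keeping the form of $A$. 3. By row operations of type 3 make $C=0$ in case (a), and make the upper left $m\times m$ block of $C$ zero in case (b). 4. In case (b), interchange $i$ and $-i$ for each $m<i\le l$, then bring $A$ to the form $\mathrm{diag}(1,\dots,1,\lambda)$, $\lambda\neq0$, by row and column operations of type 1, and, if $n=2l+1$, make $X=0=E$ by row and column operations of type 4. In both cases the matrix is now $\begin{pmatrix}A&B\\0&A^{-1}\end{pmatrix}$ if $n=2l$, and $\begin{pmatrix}\alpha&0&0\\0&A&B\\0&0&A^{-1}\end{pmatrix}$ if $n=2l+1$, with $A=\mathrm{diag}(1,\dots,1,\lambda)$. 5. By row operations of type 2 make $B=0$. The result is $\mathrm{diag}(1,\dots,1,\lambda,1,\dots,1,\lambda^{-1})$ if $n=2l$, and $\mathrm{diag}(\alpha,1,\dots,1,\lambda,1,\dots,1,\lambda^{-1})$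 if $n=2l+1$. The algorithm outputs $\lambda\in k^\times$. Then the following holds for every $g\in\mathrm O(n,k)$. - $g$ is a product of reflections, and $\Theta(g)$ does not depend on the product chosen. - The elimination algorithm can be carried out on $g$. - Whatever operations are chosen, the entry $\lambda$ that the algorithm outputs satisfies $\Theta(g)=\lambda k^{\times2}$. If moreover $g\in\mathrm{SO}(n,k)$, then $g$ lies in the commutator subgroup $[\mathrm O(n,k),\mathrm O(n,k)]$ if and only if $\lambda$ is a square in $k$. - The same two assertions hold for every $\lambda\in k^\times$ such that some finite sequence of row and column operations by elementary matrices, in any order, turns $g$ into $\mathrm{diag}(1,\dots,1,\lambda,1,\dots,1,\lambda^{-1})$ if $n=2l$, or into $\mathrm{diag}(\alpha,1,\dots,1,\lambda,1,\dots,1,\lambda^{-1})$ for some $\alpha\in k$ if $n=2l+1$. -/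

import Mathlib

open Matrix

namespace SplitOrth

noncomputable section

/-! ### Orthogonal groups and the spinor norm of a symmetric matrix -/

section General

variable {ι k : Type*} [Fintype ι] [DecidableEq ι] [Field k]

/-- The value `β(u, v) = ᵗu β v` of the bilinear form with matrix `β`. -/
def bil (β : Matrix ι ι k) (u v : ι → k) : k := u ⬝ᵥ (β *ᵥ v)

/-- The orthogonal group `{g ∈ GL | ᵗg β g = β}` of the form with matrix `β`. -/
def orthGroup (β : Matrix ι ι k) : Subgroup (GL ι k) where
  carrier := {g | (g : Matrix ι ι k)ᵀ * β * (g : Matrix ι ι k) = β}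
  one_mem' := by simp
  mul_mem' := by
    intro a b ha hb
    simp only [Set.mem_ofPred_eq] at ha hb ⊢
    calc _ = (b : Matrix ι ι k)ᵀ * ((a : Matrix ι ι k)ᵀ * β * (a : Matrix ι ι k))
              * (b : Matrix ι ι k) := by
            simp only [Units.val_mul, Matrix.transpose_mul, Matrix.mul_assoc]
      _ = β := by rw [ha, hb]
  inv_mem' := by
    intro a ha
    simp only [Set.mem_ofPred_eq] at ha ⊢
    have h1 : (a : Matrix ι ι k) * ((a⁻¹ : GL ι k) : Matrix ι ι k) = 1 := a.mul_inv
    have h2 : ((a⁻¹ : GL ι k) : Matrix ι ι k)ᵀ * (a : Matrix ι ι k)ᵀ = 1 := by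
      rw [← Matrix.transpose_mul, h1, Matrix.transpose_one]
    calc ((a⁻¹ : GL ι k) : Matrix ι ι k)ᵀ * β * ((a⁻¹ : GL ι k) : Matrix ι ι k)
        = ((a⁻¹ : GL ι k) : Matrix ι ι k)ᵀ * ((a : Matrix ι ι k)ᵀ * β * (a : Matrix ι ι k))
            * ((a⁻¹ : GL ι k) : Matrix ι ι k) := by rw [ha]
      _ = (((a⁻¹ : GL ι k) : Matrix ι ι k)ᵀ * (a : Matrix ι ι k)ᵀ) * β *
            ((a : Matrix ι ι k) * ((a⁻¹ : GL ι k) : Matrix ι ι k)) := by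
            simp only [Matrix.mul_assoc]
      _ = β := by rw [h1, h2, Matrix.one_mul, Matrix.mul_one]

/-- The underlying matrix of an element of the orthogonal group. -/
def toMat {β : Matrix ι ι k} (g : orthGroup β) : Matrix ι ι k := ((g : GL ι k) : Matrix ι ι k)

/-- The matrix of the reflection `ρ_u : v ↦ v - 2 (β(u, v) / β(u, u)) u`
in the hyperplane orthogonal to `u` (meaningful for `β(u, u) ≠ 0`). -/
def refl (β : Matrix ι ι k) (u : ι → k) : Matrix ι ι k :=
  1 - (2 / bil β u u) • vecMulVec u (u ᵥ* β)

/-- `g = ρ_{u₁} ⋯ ρ_{u_m}` with all `β(u_i, u_i) ≠ 0`. -/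
def IsProdOfReflections (β : Matrix ι ι k) (g : orthGroup β) (us : List (ι → k)) : Prop :=
  (∀ u ∈ us, bil β u u ≠ 0) ∧ toMat g = (us.map (refl β)).prod

/-- The group of square classes `k^× / k^{×2}`. -/
abbrev SqClass (k : Type*) [Field k] : Type _ := kˣ ⧸ Subgroup.square kˣ

/-- The class of `a` in `k^× / k^{×2}`. -/
def sqClass (a : kˣ) : SqClass k := QuotientGroup.mk a

open Classical in
/-- The spinor norm: the class of `∏ ½ β(u_i, u_i)` in `k^× / k^{×2}`,
where `g = ρ_{u₁} ⋯ ρ_{u_m}` is written as a product of reflections. (One such expression is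
chosen; the value `1` is used if there were none.) -/
def spinorNorm (β : Matrix ι ι k) (g : orthGroup β) : SqClass k :=
  if h : ∃ a : kˣ, ∃ us : List (ι → k), IsProdOfReflections β g us ∧
      (a : k) = (us.map fun u => bil β u u / 2).prod
  then sqClass h.choose else 1

/-- `Ops R C g h`: the matrix `h` is obtained from `g` by finitely many row operations
`g ↦ x g` with `x ∈ R` and column operations `g ↦ g x` with `x ∈ C`, in any order. -/
def Ops (R C : Set (Matrix ι ι k)) : Matrix ι ι k → Matrix ι ι k → Prop :=
  Relation.ReflTransGen fun g h => (∃ x ∈ R, h = x * g) ∨ (∃ x ∈ C, h = g * x)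

end General

/-! ### Elementary matrices

The rows and columns are indexed by `ι`; the map `p` gives the indices `1, …, l`, the map `n` the
indices `-1, …, -l`, and `z` (in odd dimension) is the index `0`. -/

section Elementary

variable {ι : Type*} [Fintype ι] [DecidableEq ι] {l : ℕ}

/-- `x_{i,j}(t) = I + t (e_{i,j} - e_{-j,-i})` for `i ≠ j`. -/
def E1 (k : Type*) [Field k] (p n : Fin l → ι) : Set (Matrix ι ι k) :=
  {x | ∃ (i j : Fin l) (t : k), i ≠ j ∧
    x = 1 + t • (single (p i) (p j) 1 - single (n j) (n i) 1)}

/-- `x_{i,-j}(t) = I + t (e_{i,-j} - e_{j,-i})` for `i < j`. -/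
def E2 (k : Type*) [Field k] (p n : Fin l → ι) : Set (Matrix ι ι k) :=
  {x | ∃ (i j : Fin l) (t : k), i < j ∧
    x = 1 + t • (single (p i) (n j) 1 - single (p j) (n i) 1)}

/-- `x_{-i,j}(t) = I + t (e_{-i,j} - e_{-j,i})` for `i < j`. -/
def E3 (k : Type*) [Field k] (p n : Fin l → ι) : Set (Matrix ι ι k) :=
  {x | ∃ (i j : Fin l) (t : k), i < j ∧
    x = 1 + t • (single (n i) (p j) 1 - single (n j) (p i) 1)}

/-- `x_{i,0}(t) = I + t (2 e_{i,0} - e_{0,-i}) - t² e_{i,-i}` and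
`x_{0,i}(t) = I + t (-2 e_{-i,0} + e_{0,i}) - t² e_{-i,i}`. -/
def E4 (k : Type*) [Field k] (z : ι) (p n : Fin l → ι) : Set (Matrix ι ι k) :=
  {x | ∃ (i : Fin l) (t : k),
    x = 1 + t • ((2 : k) • single (p i) z 1 - single z (n i) 1) - t ^ 2 • single (p i) (n i) 1 ∨
    x = 1 + t • (-((2 : k) • single (n i) z 1) + single z (p i) 1) - t ^ 2 • single (n i) (p i) 1}

/-- `I - e_{i,i} - e_{-i,-i} - e_{i,-i} - e_{-i,i}`. -/
def wMat (k : Type*) [Field k] (p n : Fin l → ι) (i : Fin l) : Matrix ι ι k :=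
  1 - single (p i) (p i) 1 - single (n i) (n i) 1 - single (p i) (n i) 1 - single (n i) (p i) 1

/-- The singleton of `w_l`, the above matrix for `i = l` (indices in `Fin l` start at `0`). -/
def Ew (k : Type*) [Field k] (p n : Fin l → ι) : Set (Matrix ι ι k) :=
  {x | ∃ i : Fin l, (i : ℕ) + 1 = l ∧ x = wMat k p n i}

/-- The block `A` of `g`: rows and columns `1, …, l`. -/
def blockA {k : Type*} (p : Fin l → ι) (g : Matrix ι ι k) : Matrix (Fin l) (Fin l) k :=
  g.submatrix p p

/-- The block `C` of `g`: rows `-1, …, -l` and columns `1, …, l`. -/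
def blockC {k : Type*} (p n : Fin l → ι) (g : Matrix ι ι k) : Matrix (Fin l) (Fin l) k :=
  g.submatrix n p

end Elementary

section Shapes

variable {k : Type*} [Field k]

/-- The `l × l` matrix `diag(1, …, 1, c)`. -/
def diagLam (l : ℕ) (c : k) : Matrix (Fin l) (Fin l) k :=
  diagonal fun i => if (i : ℕ) + 1 = l then c else 1

/-- The `l × l` matrix `diag(1, …, 1, 0, …, 0)` with `m` ones. -/
def diagRank (k : Type*) [Field k] (l m : ℕ) : Matrix (Fin l) (Fin l) k :=
  diagonal fun i => if (i : ℕ) < m then 1 else 0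

end Shapes

/-! ### Even dimension `2l`: indices `1, …, l, -1, …, -l` -/

section Even

variable {l : ℕ} {k : Type*} [Field k]

abbrev EvenIdx (l : ℕ) : Type := Fin l ⊕ Fin l

/-- The split form in dimension `2l`. -/
def evenForm (l : ℕ) (k : Type*) [Field k] : Matrix (EvenIdx l) (EvenIdx l) k :=
  fromBlocks 0 1 1 0

def ep : Fin l → EvenIdx l := Sum.inl
def en : Fin l → EvenIdx l := Sum.inr

/-- All elementary matrices in dimension `2l`. -/
def EvenElem (l : ℕ) (k : Type*) [Field k] : Set (Matrix (EvenIdx l) (EvenIdx l) k) :=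
  E1 k ep en ∪ E2 k ep en ∪ E3 k ep en ∪ Ew k ep en

/-- The product of the interchanges `w_{i,-i}` of `i` and `-i` for `m < i ≤ l`. -/
def evenSwap (k : Type*) [Field k] (l m : ℕ) : Matrix (EvenIdx l) (EvenIdx l) k :=
  (((List.finRange l).filter fun i : Fin l => m ≤ (i : ℕ)).map (wMat k ep en)).prod

/-- `diag(1, …, 1, λ, 1, …, 1, λ⁻¹)`. -/
def evenDiag (l : ℕ) (lam : kˣ) : Matrix (EvenIdx l) (EvenIdx l) k :=
  fromBlocks (diagLam l (lam : k)) 0 0 (diagLam l ((lam⁻¹ : kˣ) : k))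

/-- Step 1: by ER1 and EC1 the block `A` is brought to the form `diag(1, …, 1, λ)`, `λ ≠ 0`,
or `diag(1, …, 1, 0, …, 0)`. -/
def EvenStep1 (g g₁ : Matrix (EvenIdx l) (EvenIdx l) k) : Prop :=
  Ops (E1 k ep en) (E1 k ep en) g g₁ ∧
    ((∃ lam : kˣ, blockA ep g₁ = diagLam l (lam : k)) ∨
      ∃ m < l, blockA ep g₁ = diagRank k l m)

/-- Step 2: if `A` is `diag(1, …, 1, λ)`, then `C` is made zero by ER3. If `A` has `m < l` ones and
zeros otherwise, then the upper left `m × m` block of `C` is made zero by ER3, the rows `i` and `-i`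
are interchanged for `i > m`, and `A` is made diagonal again by ER1 and EC1. -/
def EvenStep2 (g₁ g₂ : Matrix (EvenIdx l) (EvenIdx l) k) : Prop :=
  (((∃ lam : kˣ, blockA ep g₁ = diagLam l (lam : k)) ∧ Ops (E3 k ep en) ∅ g₁ g₂) ∨
    (∃ m < l, blockA ep g₁ = diagRank k l m ∧
      ∃ h, Ops (E3 k ep en) ∅ g₁ h ∧
        (∀ i j : Fin l, (i : ℕ) < m → (j : ℕ) < m → blockC ep en h i j = 0) ∧
        Ops (E1 k ep en) (E1 k ep en) (evenSwap k l m * h) g₂)) ∧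
  ∃ (lam : kˣ) (B : Matrix (Fin l) (Fin l) k),
    g₂ = fromBlocks (diagLam l (lam : k)) B 0 (diagLam l ((lam⁻¹ : kˣ) : k))

/-- Step 3: the block `B` is made zero by ER2, leaving `diag(1, …, 1, λ, 1, …, 1, λ⁻¹)`. -/
def EvenStep3 (g₂ : Matrix (EvenIdx l) (EvenIdx l) k) (lam : kˣ) : Prop :=
  Ops (E2 k ep en) ∅ g₂ (evenDiag l lam)

/-- A run of the elimination algorithm on `g` ends in `diag(1, …, 1, λ, 1, …, 1, λ⁻¹)`. -/
def EvenOutputs (g : Matrix (EvenIdx l) (EvenIdx l) k) (lam : kˣ) : Prop :=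
  ∃ g₁ g₂, EvenStep1 g g₁ ∧ EvenStep2 g₁ g₂ ∧ EvenStep3 g₂ lam

/-- Some sequence of elementary row and column operations, in whatever order, turns `g` into
`diag(1, …, 1, λ, 1, …, 1, λ⁻¹)`. -/
def EvenReduces (g : Matrix (EvenIdx l) (EvenIdx l) k) (lam : kˣ) : Prop :=
  Ops (EvenElem l k) (EvenElem l k) g (evenDiag l lam)

end Even

/-! ### Odd dimension `2l + 1`: indices `0, 1, …, l, -1, …, -l` -/

section Odd

variable {l : ℕ} {k : Type*} [Field k]

abbrev OddIdx (l : ℕ) : Type := Unit ⊕ (Fin l ⊕ Fin l)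

/-- The split form in dimension `2l + 1`. -/
def oddForm (l : ℕ) (k : Type*) [Field k] : Matrix (OddIdx l) (OddIdx l) k :=
  fromBlocks (diagonal fun _ => 2) 0 0 (fromBlocks 0 1 1 0)

def oz : OddIdx l := Sum.inl ()
def op : Fin l → OddIdx l := fun i => Sum.inr (Sum.inl i)
def on : Fin l → OddIdx l := fun i => Sum.inr (Sum.inr i)

/-- All elementary matrices in dimension `2l + 1`. -/
def OddElem (l : ℕ) (k : Type*) [Field k] : Set (Matrix (OddIdx l) (OddIdx l) k) :=
  E1 k op on ∪ E2 k op on ∪ E3 k op on ∪ E4 k oz op on ∪ Ew k op on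

/-- The product of the interchanges `w_{i,-i} = I - 2 e_{0,0} - e_{i,-i} - e_{-i,i} - e_{i,i} -
e_{-i,-i}` for `m < i ≤ l`. -/
def oddSwap (k : Type*) [Field k] (l m : ℕ) : Matrix (OddIdx l) (OddIdx l) k :=
  (((List.finRange l).filter fun i : Fin l => m ≤ (i : ℕ)).map
    fun i => wMat k op on i - (2 : k) • single oz oz 1).prod

/-- The block matrix with rows `(α, 0, 0)`, `(0, A, B)`, `(0, 0, D)`. -/
def oddBlock (a : k) (A B D : Matrix (Fin l) (Fin l) k) : Matrix (OddIdx l) (OddIdx l) k :=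
  fromBlocks (diagonal fun _ => a) 0 0 (fromBlocks A B 0 D)

/-- `diag(α, 1, …, 1, λ, 1, …, 1, λ⁻¹)`. -/
def oddDiag (l : ℕ) (a : k) (lam : kˣ) : Matrix (OddIdx l) (OddIdx l) k :=
  oddBlock a (diagLam l (lam : k)) 0 (diagLam l ((lam⁻¹ : kˣ) : k))

/-- Step 1: by ER1 and EC1 the block `A` is brought to the form `diag(1, …, 1, λ)`, `λ ≠ 0`,
or `diag(1, …, 1, 0, …, 0)`. -/
def OddStep1 (g g₁ : Matrix (OddIdx l) (OddIdx l) k) : Prop :=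
  Ops (E1 k op on) (E1 k op on) g g₁ ∧
    ((∃ lam : kˣ, blockA op g₁ = diagLam l (lam : k)) ∨
      ∃ m < l, blockA op g₁ = diagRank k l m)

/-- The first `m` entries of the row `X` (row `0`, columns `1, …, l`) and of the column `E`
(rows `1, …, l`, column `0`) vanish. -/
def XEZero (m : ℕ) (g : Matrix (OddIdx l) (OddIdx l) k) : Prop :=
  ∀ i : Fin l, (i : ℕ) < m → g oz (op i) = 0 ∧ g (op i) oz = 0

/-- The form of the matrix in the first case after Step 2: `A = diag(1, …, 1, λ)`, `X = 0 = E`. -/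
def OddFull (g : Matrix (OddIdx l) (OddIdx l) k) : Prop :=
  (∃ lam : kˣ, blockA op g = diagLam l (lam : k)) ∧ XEZero l g

/-- The form of the matrix in the second case after Step 2: `A = diag(1, …, 1, 0, …, 0)` with
`m < l` ones, and the first `m` entries of `X` and `E` vanish. -/
def OddPartial (m : ℕ) (g : Matrix (OddIdx l) (OddIdx l) k) : Prop :=
  m < l ∧ blockA op g = diagRank k l m ∧ XEZero m g

/-- Step 2: `X` and `E` are cleared as far as `A` allows, by ER4, ER4a, EC4, EC4a. -/
def OddStep2 (g₁ g₂ : Matrix (OddIdx l) (OddIdx l) k) : Prop :=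
  Ops (E4 k oz op on) (E4 k oz op on) g₁ g₂ ∧ (OddFull g₂ ∨ ∃ m, OddPartial m g₂)

/-- Step 3: by ER3, `C` is made zero in the first case, and its upper left `m × m` block is made
zero in the second case. -/
def OddStep3 (g₂ g₃ : Matrix (OddIdx l) (OddIdx l) k) : Prop :=
  Ops (E3 k op on) ∅ g₂ g₃ ∧
    ((OddFull g₃ ∧ blockC op on g₃ = 0) ∨
      ∃ m, OddPartial m g₃ ∧
        ∀ i j : Fin l, (i : ℕ) < m → (j : ℕ) < m → blockC op on g₃ i j = 0)

/-- Step 4: nothing is done in the first case. In the second case `i` and `-i` are interchanged for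
`i > m`, then `A` is made diagonal by ER1 and EC1, and then `X` and `E` are cleared by ER4, ER4a,
EC4, EC4a. -/
def OddStep4 (g₃ g₄ : Matrix (OddIdx l) (OddIdx l) k) : Prop :=
  ((OddFull g₃ ∧ g₄ = g₃) ∨
    (∃ m, OddPartial m g₃ ∧ ∃ h, Ops (E1 k op on) (E1 k op on) (oddSwap k l m * g₃) h ∧
      Ops (E4 k oz op on) (E4 k oz op on) h g₄)) ∧
  ∃ (a : k) (lam : kˣ) (B : Matrix (Fin l) (Fin l) k),
    g₄ = oddBlock a (diagLam l (lam : k)) B (diagLam l ((lam⁻¹ : kˣ) : k))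

/-- Step 5: the block `B` is made zero by ER2, leaving `diag(α, 1, …, 1, λ, 1, …, 1, λ⁻¹)`. -/
def OddStep5 (g₄ : Matrix (OddIdx l) (OddIdx l) k) (lam : kˣ) : Prop :=
  ∃ a : k, Ops (E2 k op on) ∅ g₄ (oddDiag l a lam)

/-- A run of the elimination algorithm on `g` ends in some `diag(α, 1, …, 1, λ, 1, …, 1, λ⁻¹)`. -/
def OddOutputs (g : Matrix (OddIdx l) (OddIdx l) k) (lam : kˣ) : Prop :=
  ∃ g₁ g₂ g₃ g₄, OddStep1 g g₁ ∧ OddStep2 g₁ g₂ ∧ OddStep3 g₂ g₃ ∧ OddStep4 g₃ g₄ ∧ OddStep5 g₄ lam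

/-- Some sequence of elementary row and column operations, in whatever order, turns `g` into
`diag(α, 1, …, 1, λ, 1, …, 1, λ⁻¹)` for some `α`. -/
def OddReduces (g : Matrix (OddIdx l) (OddIdx l) k) (lam : kˣ) : Prop :=
  ∃ a : k, Ops (OddElem l k) (OddElem l k) g (oddDiag l a lam)

end Odd

end

end SplitOrth

namespace SplitOrth

noncomputable section

/-! ### Elements of a Clifford algebra that are annihilated by all contractions -/

section Clifford

open CliffordAlgebra

variable {k M : Type*} [Field k] [AddCommGroup M] [Module k M] {Q : QuadraticForm k M}

/-! The output `λ` is controlled by an invariant: the spinor norm is a homomorphism, every matrix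
used by the algorithm has trivial spinor norm, and the final diagonal matrix has spinor norm `λ`.

Well-definedness comes from the Clifford algebra of `½β`. If `ρ_{u₁} ⋯ ρ_{u_m} = 1`, then `y = u₁ ⋯
u_m` satisfies `involute y * x = x * y` for every vector `x`, so all contractions of `y` vanish and
`y` is a scalar `c` (`exists_eq_algebraMap_of_contractLeft_eq_zero`). Multiplying by the reversed
product gives `∏ ½β(u_i, u_i) = c²` (`exists_prod_eq_sq_of_prod_refl_eq_one`). Reflections generate
because the images of an orthogonal basis can be moved back one vector at a time.

The matrices of types 1 to 4 are exponentials of nilpotent `N`, hence squares of orthogonal matrices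
(`hasSpinorNorm_exp`). The interchanges are products of reflections in vectors with `β(u, u) = 2`.
On a hyperbolic pair `e, f`, the matrix `diag(λ, λ⁻¹)` is `ρ_{e+f} ρ_{e+λf}`. In odd dimension `α =
±1`, and the sign is a reflection of trivial norm.

For the commutator subgroup (`mem_commutator_iff`), reflections in vectors of equal length are
conjugate, and the hyperbolic plane contains vectors of every length. Hence the class of `g` in the
abelianization depends only on the parity of the number of reflections and on the spinor norm.

The algorithm can be carried out because type 1 operations realize all of `SL_l` on `A`, while `ᵗgβg
= β` makes the block to be cleared alternating relative to `A`. In the rank-deficient case the same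
relations show that the interchanges make `C` zero. Then `ᵗA D = 1`, where `D` is the lower right
block, so the new `A` is invertible. -/

theorem contractLeft_mul_of_mem_adjoin {d : Module.Dual k M} {S : Set M} (hd : ∀ m ∈ S, d m = 0)
    {x : CliffordAlgebra Q} (hx : x ∈ Algebra.adjoin k (ι Q '' S)) (y : CliffordAlgebra Q) :
    contractLeft d (x * y) = involute x * contractLeft d y := by
  induction hx using Algebra.adjoin_induction generalizing y with
  | mem x hx =>
    obtain ⟨m, hm, rfl⟩ := hx
    simp [contractLeft_ι_mul, hd m hm]
  | algebraMap r => simp [contractLeft_algebraMap_mul]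
  | add x x' _ _ hx hx' => simp [add_mul, hx, hx']
  | mul x x' _ _ hx hx' => simp [mul_assoc, hx, hx']

theorem contractLeft_eq_zero_of_mem_adjoin {d : Module.Dual k M} {S : Set M}
    (hd : ∀ m ∈ S, d m = 0) {x : CliffordAlgebra Q} (hx : x ∈ Algebra.adjoin k (ι Q '' S)) :
    contractLeft d x = 0 := by
  have h := contractLeft_mul_of_mem_adjoin hd hx 1
  simpa using h

theorem involute_mem_adjoin {S : Set M} {x : CliffordAlgebra Q}
    (hx : x ∈ Algebra.adjoin k (ι Q '' S)) : involute x ∈ Algebra.adjoin k (ι Q '' S) := by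
  induction hx using Algebra.adjoin_induction with
  | mem x hx =>
    obtain ⟨m, hm, rfl⟩ := hx
    rw [involute_ι]
    exact neg_mem (Algebra.subset_adjoin ⟨m, hm, rfl⟩)
  | algebraMap r => simp
  | add x x' _ _ hx hx' => rw [map_add]; exact add_mem hx hx'
  | mul x x' _ _ hx hx' => rw [map_mul]; exact mul_mem hx hx'

/-- Orthogonal vectors anticommute, so passing `w` through a product costs one sign per factor. -/
theorem mul_ι_of_mem_adjoin {S : Set M} {w : M} (hw : ∀ m ∈ S, QuadraticMap.polar Q m w = 0)
    {x : CliffordAlgebra Q} (hx : x ∈ Algebra.adjoin k (ι Q '' S)) :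
    x * ι Q w = ι Q w * involute x := by
  induction hx using Algebra.adjoin_induction with
  | mem x hx =>
    obtain ⟨m, hm, rfl⟩ := hx
    rw [ι_mul_ι_comm, hw m hm, involute_ι]
    simp
  | algebraMap r => simp [Algebra.commutes]
  | add x x' _ _ hx hx' => simp [add_mul, mul_add, hx, hx']
  | mul x x' _ _ hx hx' => rw [mul_assoc, hx', ← mul_assoc, hx, map_mul, mul_assoc]

/-- Since `w` can be moved to the left and `w²` is a scalar, at most one factor `w` survives. -/
theorem exists_decomposition_of_mem_adjoin_insert {S : Set M} {w : M}
    (hw : ∀ m ∈ S, QuadraticMap.polar Q m w = 0)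
    {x : CliffordAlgebra Q} (hx : x ∈ Algebra.adjoin k (ι Q '' insert w S)) :
    ∃ b ∈ Algebra.adjoin k (ι Q '' S), ∃ c ∈ Algebra.adjoin k (ι Q '' S), x = b + ι Q w * c := by
  induction hx using Algebra.adjoin_induction with
  | mem x hx =>
    obtain ⟨m, rfl | hm, rfl⟩ := hx
    · exact ⟨0, zero_mem _, 1, one_mem _, by simp⟩
    · exact ⟨_, Algebra.subset_adjoin ⟨m, hm, rfl⟩, 0, zero_mem _, by simp⟩
  | algebraMap r => exact ⟨_, Subalgebra.algebraMap_mem _ r, 0, zero_mem _, by simp⟩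
  | add x x' _ _ hx hx' =>
    obtain ⟨b, hb, c, hc, rfl⟩ := hx
    obtain ⟨b', hb', c', hc', rfl⟩ := hx'
    exact ⟨_, add_mem hb hb', _, add_mem hc hc', by rw [mul_add]; abel⟩
  | mul x x' _ _ hx hx' =>
    obtain ⟨b, hb, c, hc, rfl⟩ := hx
    obtain ⟨b', hb', c', hc', rfl⟩ := hx'
    refine ⟨b * b' + algebraMap k _ (Q w) * (involute c * c'),
      add_mem (mul_mem hb hb') (mul_mem (Subalgebra.algebraMap_mem _ _)
        (mul_mem (involute_mem_adjoin hc) hc')),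
      involute b * c' + c * b',
      add_mem (mul_mem (involute_mem_adjoin hb) hc') (mul_mem hc hb'), ?_⟩
    have h1 : b * (ι Q w * c') = ι Q w * (involute b * c') := by
      rw [← mul_assoc, mul_ι_of_mem_adjoin hw hb, mul_assoc]
    have h2 : ι Q w * c * (ι Q w * c') = algebraMap k _ (Q w) * (involute c * c') := by
      rw [mul_assoc, ← mul_assoc c, mul_ι_of_mem_adjoin hw hc, mul_assoc (ι Q w), ← mul_assoc,
        ι_sq_scalar]
    rw [add_mul, mul_add, mul_add, h1, h2, mul_add, mul_assoc (ι Q w)]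
    abel

/-- Basis vectors are removed one at a time. If `x = b + v_i c` with `b`, `c` free of `v_i`,
contraction with the `i`-th coordinate kills `b` and turns `v_i c` into `c`; hence `c = 0`. -/
theorem exists_eq_algebraMap_of_contractLeft_eq_zero {κ : Type*} [Finite κ]
    (v : Module.Basis κ k M) (hv : ∀ i j, i ≠ j → QuadraticMap.polar Q (v i) (v j) = 0)
    {x : CliffordAlgebra Q} (hx : ∀ d : Module.Dual k M, contractLeft d x = 0) :
    ∃ c : k, x = algebraMap k _ c := by
  classical
  have := Fintype.ofFinite κ
  -- Here `s` is the set of basis vectors already shown not to be needed to express `x`.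
  have key : ∀ s : Finset κ, x ∈ Algebra.adjoin k (ι Q '' (v '' {i | i ∉ s})) := by
    intro s
    induction s using Finset.induction_on with
    | empty =>
      have h : Algebra.adjoin k (ι Q '' (v '' {i | i ∉ (∅ : Finset κ)})) = ⊤ := by
        rw [eq_top_iff, ← adjoin_range_ι, Algebra.adjoin_le_iff]
        rintro _ ⟨m, rfl⟩
        rw [← v.sum_repr m, map_sum]
        refine sum_mem fun i _ => ?_
        rw [map_smul]
        have hi : ι Q (v i) ∈ ι Q '' (v '' {i | i ∉ (∅ : Finset κ)}) := ⟨_, ⟨i, by simp, rfl⟩, rfl⟩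
        exact Subalgebra.smul_mem _ (Algebra.subset_adjoin hi) _
      rw [h]; trivial
    | insert i s hi ih =>
      have hset : v '' {j | j ∉ s} = insert (v i) (v '' {j | j ∉ insert i s}) := by
        rw [← Set.image_insert_eq]
        congr 1
        ext j
        by_cases hj : j = i
        · subst hj; simpa using hi
        · simp [hj]
      rw [hset] at ih
      have horth : ∀ m ∈ v '' {j | j ∉ insert i s}, QuadraticMap.polar Q m (v i) = 0 := by
        rintro _ ⟨j, hj, rfl⟩
        refine hv j i ?_
        rintro rfl
        simp at hj
      have hcoord : ∀ m ∈ v '' {j | j ∉ insert i s}, v.coord i m = 0 := by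
        rintro _ ⟨j, hj, rfl⟩
        have : j ≠ i := by rintro rfl; simp at hj
        simp [this]
      obtain ⟨b, hb, c, hc, rfl⟩ := exists_decomposition_of_mem_adjoin_insert horth ih
      have h := hx (v.coord i)
      rw [map_add, contractLeft_eq_zero_of_mem_adjoin hcoord hb, contractLeft_ι_mul,
        contractLeft_eq_zero_of_mem_adjoin hcoord hc] at h
      simp only [Module.Basis.coord_apply, Module.Basis.repr_self, Finsupp.single_eq_same, one_smul,
        mul_zero, sub_zero, zero_add] at h
      simpa [h] using hb
  have h := key Finset.univ
  simp only [Finset.mem_univ, not_true_eq_false, Set.ofPred_false, Set.image_empty,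
    Algebra.adjoin_empty] at h
  obtain ⟨c, hc⟩ := Algebra.mem_bot.mp h
  exact ⟨c, hc.symm⟩

/-- Contraction along the polar form is a twisted commutator; this turns a commutation property into
the vanishing of contractions. -/
theorem contractLeft_polar_prod_ι (x : M) (us : List M) :
    contractLeft (QuadraticMap.polarBilin Q x) (us.map (ι Q)).prod =
      ι Q x * (us.map (ι Q)).prod - involute (us.map (ι Q)).prod * ι Q x := by
  induction us with
  | nil => simp
  | cons u us ih =>
    rw [List.map_cons, List.prod_cons, contractLeft_ι_mul, ih, map_mul, involute_ι,
      QuadraticMap.polarBilin_apply_apply, Algebra.smul_def, ← ι_mul_ι_add_swap]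
    noncomm_ring

end Clifford

/-! ### Reflections and the spinor norm of a nondegenerate symmetric form -/

section General

section

variable {ι k : Type*} [Fintype ι] [Field k] {β : Matrix ι ι k}

theorem bil_comm (hβ : βᵀ = β) (u v : ι → k) : bil β u v = bil β v u := by
  rw [bil, bil, dotProduct_mulVec, ← mulVec_transpose, hβ, dotProduct_comm]

theorem prod_half_bil_ne_zero (h2 : (2 : k) ≠ 0) {us : List (ι → k)}
    (hus : ∀ u ∈ us, bil β u u ≠ 0) :
    (us.map fun u => bil β u u / 2).prod ≠ 0 := by
  refine List.prod_ne_zero fun h => ?_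
  obtain ⟨u, hu, h⟩ := List.mem_map.mp h
  exact div_ne_zero (hus u hu) h2 h

end

variable {ι k : Type*} [Fintype ι] [DecidableEq ι] [Field k] {β : Matrix ι ι k}

theorem bil_eq_toBilin' (u v : ι → k) : bil β u v = Matrix.toBilin' β u v := by
  rw [bil, Matrix.toBilin'_apply']

theorem bil_add_left (u u' v : ι → k) : bil β (u + u') v = bil β u v + bil β u' v := by
  simp [bil_eq_toBilin']

theorem bil_add_right (u v v' : ι → k) : bil β u (v + v') = bil β u v + bil β u v' := by
  simp [bil_eq_toBilin']

theorem bil_sub_left (u u' v : ι → k) : bil β (u - u') v = bil β u v - bil β u' v := by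
  simp [bil_eq_toBilin']

theorem bil_sub_right (u v v' : ι → k) : bil β u (v - v') = bil β u v - bil β u v' := by
  simp [bil_eq_toBilin']

theorem bil_smul_left (c : k) (u v : ι → k) : bil β (c • u) v = c * bil β u v := by
  simp [bil_eq_toBilin']

theorem bil_smul_right (c : k) (u v : ι → k) : bil β u (c • v) = c * bil β u v := by
  simp [bil_eq_toBilin']

theorem refl_mulVec (u v : ι → k) :
    refl β u *ᵥ v = v - (2 * bil β u v / bil β u u) • u := by
  rw [refl, sub_mulVec, one_mulVec, smul_mulVec, vecMulVec_mulVec, ← dotProduct_mulVec, ← bil]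
  ext i
  simp
  ring

theorem refl_mul_refl {u : ι → k} (hu : bil β u u ≠ 0) : refl β u * refl β u = 1 := by
  refine Matrix.ext_of_mulVec_single fun i => ?_
  rw [← mulVec_mulVec, refl_mulVec (v := Pi.single i 1), mulVec_sub, mulVec_smul, refl_mulVec,
    refl_mulVec, one_mulVec, mul_div_assoc _ (bil β u u), div_self hu]
  ext j
  simp
  ring

theorem refl_mulVec_self {u : ι → k} (hu : bil β u u ≠ 0) : refl β u *ᵥ u = -u := by
  rw [refl_mulVec, mul_div_assoc, div_self hu]
  ext j
  simp
  ring

theorem refl_mulVec_of_orthogonal {u v : ι → k} (h : bil β u v = 0) : refl β u *ᵥ v = v := by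
  rw [refl_mulVec, h]
  simp

theorem refl_smul {c : k} (hc : c ≠ 0) (u : ι → k) : refl β (c • u) = refl β u := by
  refine Matrix.ext_of_mulVec_single fun i => ?_
  rw [refl_mulVec, refl_mulVec, bil_smul_left, bil_smul_left, bil_smul_right, smul_smul]
  congr 2
  by_cases hu : bil β u u = 0
  · simp [hu]
  · field_simp

/-- A matrix that preserves the form. -/
def Preserves (β g : Matrix ι ι k) : Prop := gᵀ * β * g = β

theorem preserves_iff_bil {g : Matrix ι ι k} :
    Preserves β g ↔ ∀ u v, bil β (g *ᵥ u) (g *ᵥ v) = bil β u v := by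
  have h : ∀ u v, bil β (g *ᵥ u) (g *ᵥ v) = bil (gᵀ * β * g) u v := by
    intro u v
    rw [bil, bil, ← mulVec_mulVec, ← mulVec_mulVec, dotProduct_mulVec u, vecMul_transpose]
  simp only [h]
  constructor
  · intro hg u v
    rw [show gᵀ * β * g = β from hg]
  · intro hg
    refine Matrix.ext fun i j => ?_
    have := hg (Pi.single i 1) (Pi.single j 1)
    simpa [bil] using this

theorem Preserves.one : Preserves β 1 := by simp [Preserves]

theorem Preserves.mul {g h : Matrix ι ι k} (hg : Preserves β g) (hh : Preserves β h) :
    Preserves β (g * h) := by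
  rw [preserves_iff_bil] at *
  intro u v
  rw [← mulVec_mulVec, ← mulVec_mulVec, hg, hh]

theorem preserves_toMat (g : orthGroup β) : Preserves β (toMat g) := g.2

theorem preserves_refl (hβ : βᵀ = β) {u : ι → k} (hu : bil β u u ≠ 0) :
    Preserves β (refl β u) := by
  rw [preserves_iff_bil]
  intro x y
  simp only [refl_mulVec, bil_sub_left, bil_sub_right, bil_smul_left, bil_smul_right,
    bil_comm hβ x u]
  field_simp
  ring

theorem Preserves.list_prod_refl (hβ : βᵀ = β) {us : List (ι → k)}
    (hus : ∀ u ∈ us, bil β u u ≠ 0) : Preserves β (us.map (refl β)).prod := by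
  induction us with
  | nil => exact Preserves.one
  | cons u us ih =>
    rw [List.map_cons, List.prod_cons]
    exact (preserves_refl hβ (hus u (by simp))).mul (ih fun v hv => hus v (by simp [hv]))

theorem isUnit_det_of_preserves (hdet : IsUnit β.det) {g : Matrix ι ι k} (hg : Preserves β g) :
    IsUnit g.det := by
  rw [← show gᵀ * β * g = β from hg, det_mul] at hdet
  exact isUnit_of_mul_isUnit_right hdet

theorem exists_toMat_eq (hdet : IsUnit β.det) {g : Matrix ι ι k} (hg : Preserves β g) :
    ∃ h : orthGroup β, toMat h = g := by
  have hu := (isUnit_iff_isUnit_det g).mpr (isUnit_det_of_preserves hdet hg)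
  exact ⟨⟨hu.unit, hg⟩, rfl⟩

theorem toMat_mul (g h : orthGroup β) : toMat (g * h) = toMat g * toMat h := rfl

theorem toMat_injective : Function.Injective (toMat : orthGroup β → Matrix ι ι k) :=
  fun _ _ h => Subtype.ext (Units.ext h)

theorem prod_refl_mul_prod_refl_reverse {us : List (ι → k)} (hus : ∀ u ∈ us, bil β u u ≠ 0) :
    (us.map (refl β)).prod * (us.reverse.map (refl β)).prod = 1 := by
  induction us with
  | nil => simp
  | cons u us ih =>
    have h := ih fun v hv => hus v (by simp [hv])
    simp only [List.map_cons, List.prod_cons, List.reverse_cons, List.map_append, List.prod_append,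
      List.map_nil, List.prod_nil, mul_one]
    calc _ = refl β u * ((us.map (refl β)).prod * (us.reverse.map (refl β)).prod) * refl β u := by
          simp only [Matrix.mul_assoc]
      _ = 1 := by rw [h, Matrix.mul_one, refl_mul_refl (hus u (by simp))]

theorem det_refl {u : ι → k} (hu : bil β u u ≠ 0) : (refl β u).det = -1 := by
  have h : refl β u =
      1 + replicateCol Unit (-(2 / bil β u u) • u) * replicateRow Unit (u ᵥ* β) := by
    rw [refl, sub_eq_add_neg]
    congr 1
    ext i j
    simp [Matrix.mul_apply, vecMulVec_apply]
    ring
  rw [h, det_one_add_replicateCol_mul_replicateRow, dotProduct_smul, ← dotProduct_mulVec, ← bil]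
  rw [smul_eq_mul, neg_mul, div_mul_cancel₀ _ hu]
  norm_num

theorem det_prod_refl {us : List (ι → k)} (hus : ∀ u ∈ us, bil β u u ≠ 0) :
    (us.map (refl β)).prod.det = (-1) ^ us.length := by
  induction us with
  | nil => simp
  | cons u us ih =>
    rw [List.map_cons, List.prod_cons, det_mul, det_refl (hus u (by simp)),
      ih fun v hv => hus v (by simp [hv]), List.length_cons, pow_succ, mul_comm]

/-- The quadratic form `½ β(u, u)`. -/
def quadForm (β : Matrix ι ι k) : QuadraticForm k (ι → k) :=
  LinearMap.BilinMap.toQuadraticMap ((2⁻¹ : k) • Matrix.toBilin' β)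

theorem quadForm_apply (u : ι → k) : quadForm β u = bil β u u / 2 := by
  simp [quadForm, bil_eq_toBilin']
  ring

theorem polar_quadForm (h2 : (2 : k) ≠ 0) (hβ : βᵀ = β) (u v : ι → k) :
    QuadraticMap.polar (quadForm β) u v = bil β u v := by
  simp only [QuadraticMap.polar, quadForm_apply, bil_add_left, bil_add_right, bil_comm hβ v u]
  field_simp
  ring

open CliffordAlgebra in
-- Twisted conjugation by a vector `u` is the reflection: `-u x = ρ_u(x) u` in the Clifford algebra
-- of `½β`. The general case iterates this.
theorem involute_prod_ι_mul_ι (h2 : (2 : k) ≠ 0) (hβ : βᵀ = β) {us : List (ι → k)}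
    (hus : ∀ u ∈ us, bil β u u ≠ 0) (x : ι → k) :
    involute (us.map (CliffordAlgebra.ι (quadForm β))).prod * CliffordAlgebra.ι (quadForm β) x =
      CliffordAlgebra.ι (quadForm β) ((us.map (refl β)).prod *ᵥ x) *
        (us.map (CliffordAlgebra.ι (quadForm β))).prod := by
  induction us with
  | nil => simp
  | cons u us ih =>
    have hu := hus u (by simp)
    simp only [List.map_cons, List.prod_cons, map_mul, involute_ι]
    rw [mul_assoc, ih fun v hv => hus v (by simp [hv]), ← mulVec_mulVec, ← mul_assoc, ← mul_assoc]
    congr 1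
    generalize (us.map (refl β)).prod *ᵥ x = y
    rw [refl_mulVec, map_sub, map_smul, sub_mul, smul_mul_assoc, ι_sq_scalar, quadForm_apply,
      neg_mul, ι_mul_ι_comm, polar_quadForm h2 hβ, Algebra.smul_def,
      ← map_mul (algebraMap k _)]
    have : 2 * bil β u y / bil β u u * (bil β u u / 2) = bil β u y := by field_simp
    rw [this]
    abel

theorem exists_orthogonal_basis (h2 : (2 : k) ≠ 0) (hβ : βᵀ = β) (hdet : IsUnit β.det) :
    ∃ (m : ℕ) (v : Module.Basis (Fin m) k (ι → k)),
      (∀ i j, i ≠ j → bil β (v i) (v j) = 0) ∧ ∀ i, bil β (v i) (v i) ≠ 0 := by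
  have : Invertible (2 : k) := invertibleOfNonzero h2
  have hsymm : LinearMap.IsSymm (Matrix.toBilin' β) := by
    refine ⟨fun x y => ?_⟩
    simp only [RingHom.id_apply]
    rw [← bil_eq_toBilin', ← bil_eq_toBilin', bil_comm hβ]
  obtain ⟨v, hv⟩ := LinearMap.BilinForm.exists_orthogonal_basis hsymm
  have hnd : (Matrix.toBilin' β).Nondegenerate :=
    Matrix.Nondegenerate.toBilin' (Matrix.nondegenerate_of_det_ne_zero hdet.ne_zero)
  refine ⟨_, v, fun i j hij => ?_, fun i => ?_⟩
  · rw [bil_eq_toBilin']; exact hv hij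
  · rw [bil_eq_toBilin']
    exact hv.not_isOrtho_basis_self_of_separatingLeft hnd.1 i

theorem exists_prod_eq_sq_of_prod_refl_eq_one (h2 : (2 : k) ≠ 0) (hβ : βᵀ = β)
    (hdet : IsUnit β.det) {us : List (ι → k)} (hus : ∀ u ∈ us, bil β u u ≠ 0)
    (h1 : (us.map (refl β)).prod = 1) :
    ∃ c : k, (us.map fun u => bil β u u / 2).prod = c ^ 2 := by
  have : Invertible (2 : k) := invertibleOfNonzero h2
  obtain ⟨m, v, hv, hv'⟩ := exists_orthogonal_basis h2 hβ hdet
  have hcontr : ∀ d : Module.Dual k (ι → k), CliffordAlgebra.contractLeft d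
      (us.map (CliffordAlgebra.ι (quadForm β))).prod = 0 := by
    intro d
    -- By nondegeneracy every functional is pairing with a vector, here written in the orthogonal
    -- basis.
    obtain ⟨x, rfl⟩ : ∃ x, QuadraticMap.polarBilin (quadForm β) x = d := by
      refine ⟨∑ i, (d (v i) / bil β (v i) (v i)) • v i, v.ext fun j => ?_⟩
      simp only [map_sum, LinearMap.sum_apply, map_smul, LinearMap.smul_apply,
        QuadraticMap.polarBilin_apply_apply, polar_quadForm h2 hβ]
      rw [Finset.sum_eq_single j]
      · rw [smul_eq_mul, div_mul_cancel₀ _ (hv' j)]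
      · intro i _ hij
        rw [hv i j hij, smul_zero]
      · simp
    rw [contractLeft_polar_prod_ι, involute_prod_ι_mul_ι h2 hβ hus, h1, one_mulVec, sub_self]
  obtain ⟨c, hc⟩ := exists_eq_algebraMap_of_contractLeft_eq_zero v
    (fun i j hij => by rw [polar_quadForm h2 hβ, hv i j hij]) hcontr
  refine ⟨c, ?_⟩
  -- The product `u_m ⋯ u₁ u₁ ⋯ u_m` collapses from the middle. As the reversal fixes scalars, it
  -- also equals `c²`.
  have key : (us.map (CliffordAlgebra.ι (quadForm β))).reverse.prod *
      (us.map (CliffordAlgebra.ι (quadForm β))).prod =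
        algebraMap k _ (us.map fun u => bil β u u / 2).prod := by
    clear hc hcontr h1 hus
    induction us with
    | nil => simp
    | cons u us ih =>
      simp only [List.map_cons, List.prod_cons, List.reverse_cons, List.prod_append,
        List.prod_nil, mul_one]
      rw [mul_assoc, ← mul_assoc (CliffordAlgebra.ι (quadForm β) u), CliffordAlgebra.ι_sq_scalar,
        Algebra.left_comm, ih, quadForm_apply, map_mul]
  rw [← CliffordAlgebra.reverse_prod_map_ι, hc, CliffordAlgebra.reverse.commutes, ← map_mul] at key
  rw [pow_two]
  exact ((algebraMap k (CliffordAlgebra (quadForm β))).injective key).symm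

/-! #### Generation by reflections -/

/-- The values of the form at `x - y` and `x + y` add up to `4β(y, y) ≠ 0`, so one of the two
vectors is anisotropic. Either `ρ_{x-y}` maps `x` to `y`, or `ρ_{x+y}` maps `x` to `-y` and `ρ_y`
corrects the sign. Only vectors in the span of `x` and `y` are used, so everything orthogonal to
both stays fixed. -/
theorem exists_prod_refl_mulVec_eq (h2 : (2 : k) ≠ 0) (hβ : βᵀ = β) {x y : ι → k}
    (hxy : bil β x x = bil β y y) (hy : bil β y y ≠ 0) :
    ∃ us : List (ι → k), (∀ u ∈ us, bil β u u ≠ 0) ∧ (us.map (refl β)).prod *ᵥ x = y ∧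
      ∀ z, bil β x z = 0 → bil β y z = 0 → (us.map (refl β)).prod *ᵥ z = z := by
  by_cases h : bil β (x - y) (x - y) = 0
  · have h' : bil β (x + y) (x + y) = 4 * bil β y y := by
      simp only [bil_sub_left, bil_sub_right, bil_add_left, bil_add_right, bil_comm hβ y x,
        hxy] at h ⊢
      linear_combination -h
    have h4 : bil β (x + y) (x + y) ≠ 0 := by
      rw [h', show (4 : k) = 2 * 2 by norm_num]
      positivity
    have hx : refl β (x + y) *ᵥ x = -y := by
      have : bil β (x + y) x = bil β (x + y) (x + y) / 2 := by
        rw [h']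
        simp only [bil_sub_left, bil_sub_right, bil_add_left, bil_comm hβ y x, hxy] at h ⊢
        field_simp
        linear_combination -h
      rw [refl_mulVec, this, mul_div_cancel₀ _ h2, div_self h4]
      simp
    refine ⟨[y, x + y], by simp [hy, h4], ?_, fun z hz hz' => ?_⟩
    · simp only [List.map_cons, List.map_nil, List.prod_cons, List.prod_nil, mul_one]
      rw [← mulVec_mulVec, hx, mulVec_neg, refl_mulVec_self hy, neg_neg]
    · simp only [List.map_cons, List.map_nil, List.prod_cons, List.prod_nil, mul_one]
      rw [← mulVec_mulVec,
        refl_mulVec_of_orthogonal (u := x + y) (by rw [bil_add_left, hz, hz', add_zero]),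
        refl_mulVec_of_orthogonal hz']
  · refine ⟨[x - y], by simpa using h, ?_, fun z hz hz' => ?_⟩
    · have : bil β (x - y) x = bil β (x - y) (x - y) / 2 := by
        simp only [bil_sub_left, bil_sub_right, bil_comm hβ y x, hxy] at h ⊢
        field_simp
        ring
      simp only [List.map_cons, List.map_nil, List.prod_cons, List.prod_nil, mul_one]
      rw [refl_mulVec, this, mul_div_cancel₀ _ h2, div_self h]
      simp
    · simp only [List.map_cons, List.map_nil, List.prod_cons, List.prod_nil, mul_one]
      exact refl_mulVec_of_orthogonal (by rw [bil_sub_left, hz, hz', sub_zero])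

theorem exists_isProdOfReflections (h2 : (2 : k) ≠ 0) (hβ : βᵀ = β) (hdet : IsUnit β.det)
    (g : orthGroup β) : ∃ us, IsProdOfReflections β g us := by
  obtain ⟨m, v, hv, hv'⟩ := exists_orthogonal_basis h2 hβ hdet
  have key : ∀ s : Finset (Fin m), ∃ us : List (ι → k), (∀ u ∈ us, bil β u u ≠ 0) ∧
      ∀ i ∈ s, ((us.map (refl β)).prod * toMat g) *ᵥ v i = v i := by
    intro s
    induction s using Finset.induction_on with
    | empty => exact ⟨[], by simp, by simp⟩
    | insert i s hi ih =>
      obtain ⟨us, hus, hfix⟩ := ih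
      set h := (us.map (refl β)).prod * toMat g with hh
      have hpres := preserves_iff_bil.mp
        ((Preserves.list_prod_refl hβ hus).mul (preserves_toMat g))
      rw [← hh] at hpres
      obtain ⟨ws, hws, hw, hw'⟩ := exists_prod_refl_mulVec_eq h2 hβ (hpres (v i) (v i)) (hv' i)
      refine ⟨ws ++ us, ?_, ?_⟩
      · intro u hu
        rcases List.mem_append.mp hu with hu | hu
        exacts [hws u hu, hus u hu]
      · intro j hj
        rw [List.map_append, List.prod_append, Matrix.mul_assoc, ← hh, ← mulVec_mulVec]
        rcases Finset.mem_insert.mp hj with rfl | hj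
        · exact hw
        · have hij : i ≠ j := by rintro rfl; exact hi hj
          rw [hfix j hj]
          refine hw' _ ?_ (hv i j hij)
          -- A basis vector `v j` fixed by `h` is orthogonal to `h v_i` because `h` preserves the
          -- form, so the new reflections fix it too.
          have := hpres (v i) (v j)
          rwa [hfix j hj, hv i j hij] at this
  obtain ⟨us, hus, hfix⟩ := key Finset.univ
  have h1 : (us.map (refl β)).prod * toMat g = 1 := by
    apply (Matrix.toLin' (R := k)).injective
    refine v.ext fun i => ?_
    rw [Matrix.toLin'_apply, Matrix.toLin'_one, hfix i (Finset.mem_univ i)]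
    rfl
  refine ⟨us.reverse, by simpa using hus, ?_⟩
  have h2 := prod_refl_mul_prod_refl_reverse hus
  rw [mul_eq_one_comm] at h2
  calc toMat g = (us.reverse.map (refl β)).prod * (us.map (refl β)).prod * toMat g := by
        rw [h2, Matrix.one_mul]
    _ = _ := by rw [Matrix.mul_assoc, h1, Matrix.mul_one]

/-! #### The spinor norm as a homomorphism -/

theorem sqClass_eq_sqClass {a b : kˣ} : sqClass a = sqClass b ↔ IsSquare (a * b) := by
  rw [sqClass, sqClass, QuotientGroup.eq, Subgroup.mem_square]
  constructor
  · rintro ⟨r, hr⟩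
    exact ⟨a * r, by rw [mul_mul_mul_comm, ← hr]; group⟩
  · rintro ⟨r, hr⟩
    exact ⟨a⁻¹ * r, by rw [mul_mul_mul_comm, ← hr]; group⟩

theorem sqClass_mul (a b : kˣ) : sqClass (a * b) = sqClass a * sqClass b := rfl

theorem sqClass_one : sqClass (1 : kˣ) = 1 := rfl

theorem sqClass_eq_one {a : kˣ} : sqClass a = 1 ↔ IsSquare (a : k) := by
  rw [← sqClass_one, sqClass_eq_sqClass, mul_one]
  constructor
  · rintro ⟨r, rfl⟩
    exact ⟨r, by simp⟩
  · rintro ⟨r, hr⟩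
    have : r ≠ 0 := by rintro rfl; simp at hr
    exact ⟨Units.mk0 r this, Units.ext hr⟩

theorem mul_self_eq_one (x : SqClass k) : x * x = 1 := by
  induction x using QuotientGroup.induction_on with
  | H a => exact (sqClass_eq_one (a := a * a)).mpr ⟨a, by simp⟩

/-- The word `us` followed by the reverse of `vs` multiplies to `1`, so `a * b` is a square, and
square classes are their own inverses. -/
theorem sqClass_eq_of_isProdOfReflections (h2 : (2 : k) ≠ 0) (hβ : βᵀ = β) (hdet : IsUnit β.det)
    {g : orthGroup β} {us vs : List (ι → k)} (hus : IsProdOfReflections β g us)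
    (hvs : IsProdOfReflections β g vs) {a b : kˣ}
    (ha : (a : k) = (us.map fun u => bil β u u / 2).prod)
    (hb : (b : k) = (vs.map fun u => bil β u u / 2).prod) : sqClass a = sqClass b := by
  obtain ⟨c, hc⟩ := exists_prod_eq_sq_of_prod_refl_eq_one (us := us ++ vs.reverse) h2 hβ hdet
    (by
      intro u hu
      rcases List.mem_append.mp hu with hu | hu
      exacts [hus.1 u hu, hvs.1 u (List.mem_reverse.mp hu)])
    (by rw [List.map_append, List.prod_append, ← hus.2, hvs.2,
          prod_refl_mul_prod_refl_reverse hvs.1])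
  rw [List.map_append, List.prod_append, List.map_reverse, List.prod_reverse, ← ha, ← hb] at hc
  have h1 : sqClass (a * b) = 1 := sqClass_eq_one.mpr ⟨c, by rw [Units.val_mul, hc, pow_two]⟩
  rw [sqClass_mul] at h1
  rw [← mul_one (sqClass a), ← mul_self_eq_one (sqClass b), ← mul_assoc, h1, one_mul]

theorem spinorNorm_eq (h2 : (2 : k) ≠ 0) (hβ : βᵀ = β) (hdet : IsUnit β.det)
    {g : orthGroup β} {us : List (ι → k)} (hus : IsProdOfReflections β g us) {a : kˣ}
    (ha : (a : k) = (us.map fun u => bil β u u / 2).prod) : spinorNorm β g = sqClass a := by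
  have h : ∃ a : kˣ, ∃ us : List (ι → k), IsProdOfReflections β g us ∧
      (a : k) = (us.map fun u => bil β u u / 2).prod := ⟨a, us, hus, ha⟩
  rw [spinorNorm, dif_pos h]
  obtain ⟨vs, hvs, hb⟩ := h.choose_spec
  exact sqClass_eq_of_isProdOfReflections h2 hβ hdet hvs hus hb ha

theorem spinorNorm_mul (h2 : (2 : k) ≠ 0) (hβ : βᵀ = β) (hdet : IsUnit β.det)
    (g h : orthGroup β) : spinorNorm β (g * h) = spinorNorm β g * spinorNorm β h := by
  obtain ⟨us, hus⟩ := exists_isProdOfReflections h2 hβ hdet g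
  obtain ⟨vs, hvs⟩ := exists_isProdOfReflections h2 hβ hdet h
  have hprod : IsProdOfReflections β (g * h) (us ++ vs) := by
    refine ⟨?_, by rw [toMat_mul, hus.2, hvs.2, List.map_append, List.prod_append]⟩
    intro u hu
    rcases List.mem_append.mp hu with hu | hu
    exacts [hus.1 u hu, hvs.1 u hu]
  rw [spinorNorm_eq (a := Units.mk0 _ (prod_half_bil_ne_zero h2 hus.1)) h2 hβ hdet hus rfl,
    spinorNorm_eq (a := Units.mk0 _ (prod_half_bil_ne_zero h2 hvs.1)) h2 hβ hdet hvs rfl,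
    ← sqClass_mul]
  refine spinorNorm_eq h2 hβ hdet hprod ?_
  simp

/-- The spinor norm as a group homomorphism. -/
def spinorHom (h2 : (2 : k) ≠ 0) (hβ : βᵀ = β) (hdet : IsUnit β.det) : orthGroup β →* SqClass k :=
  MonoidHom.mk' (spinorNorm β) (spinorNorm_mul h2 hβ hdet)

/-- The reflection `ρ_u` as an element of the orthogonal group. -/
def reflection (hβ : βᵀ = β) (u : ι → k) (hu : bil β u u ≠ 0) : orthGroup β :=
  ⟨⟨refl β u, refl β u, refl_mul_refl hu, refl_mul_refl hu⟩, preserves_refl hβ hu⟩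

theorem toMat_reflection (hβ : βᵀ = β) (u : ι → k) (hu : bil β u u ≠ 0) :
    toMat (reflection hβ u hu) = refl β u := rfl

theorem abelianization_reflection_mul_self (hβ : βᵀ = β) (u : ι → k) (hu : bil β u u ≠ 0) :
    Abelianization.of (reflection hβ u hu) * Abelianization.of (reflection hβ u hu) = 1 := by
  rw [← map_mul]
  convert map_one Abelianization.of
  exact toMat_injective (refl_mul_refl hu)

/-- An orthogonal `h` with `h u = v` conjugates `ρ_u` into `ρ_v`. -/
theorem abelianization_reflection_eq (h2 : (2 : k) ≠ 0) (hβ : βᵀ = β) (hdet : IsUnit β.det)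
    {u v : ι → k} (hu : bil β u u ≠ 0) (hv : bil β v v ≠ 0) (huv : bil β u u = bil β v v) :
    Abelianization.of (reflection hβ u hu) = Abelianization.of (reflection hβ v hv) := by
  obtain ⟨us, hus, huv', -⟩ := exists_prod_refl_mulVec_eq h2 hβ huv hv
  obtain ⟨h, hh⟩ := exists_toMat_eq hdet (Preserves.list_prod_refl hβ hus)
  have hpres := preserves_iff_bil.mp (preserves_toMat h)
  have hconj : reflection hβ v hv * h = h * reflection hβ u hu := by
    refine toMat_injective (Matrix.ext_of_mulVec_single fun i => ?_)
    rw [toMat_mul, toMat_mul, toMat_reflection, toMat_reflection, ← mulVec_mulVec,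
      ← mulVec_mulVec]
    generalize (Pi.single i 1 : ι → k) = x
    rw [refl_mulVec, refl_mulVec, mulVec_sub, mulVec_smul, ← huv, ← huv', hh.symm, hpres]
  have := congrArg Abelianization.of hconj
  rw [map_mul, map_mul, mul_comm] at this
  exact (mul_left_cancel this).symm

/-! ### The commutator subgroup in the presence of a hyperbolic plane -/

section HyperbolicPair

variable {e f : ι → k}

theorem bil_add_smul_self (hβ : βᵀ = β) (he : bil β e e = 0) (hf : bil β f f = 0)
    (hef : bil β e f = 1) (a : k) : bil β (e + a • f) (e + a • f) = 2 * a := by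
  simp only [bil_add_left, bil_add_right, bil_smul_left, bil_smul_right, he, hf, hef,
    bil_comm hβ f e]
  ring

/-- The product scales `e` by `b / a` and `f` by `a / b`, and is the identity on the orthogonal
complement. In particular it depends only on `b / a`. -/
theorem refl_mulVec_refl_mulVec (h2 : (2 : k) ≠ 0) (hβ : βᵀ = β) (he : bil β e e = 0)
    (hf : bil β f f = 0) (hef : bil β e f = 1) {a b : k} (ha : a ≠ 0) (hb : b ≠ 0) (x : ι → k) :
    refl β (e + a • f) *ᵥ (refl β (e + b • f) *ᵥ x) =
      x + ((b / a - 1) * bil β f x) • e + ((a / b - 1) * bil β e x) • f := by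
  simp only [refl_mulVec, bil_add_smul_self hβ he hf hef, bil_sub_right, bil_add_left,
    bil_add_right, bil_smul_left, bil_smul_right, he, hf, hef, bil_comm hβ f e]
  ext i
  simp only [Pi.sub_apply, Pi.add_apply, Pi.smul_apply, smul_eq_mul]
  field_simp
  ring

/-- If the form contains a hyperbolic plane, then an element of determinant `1` lies in the
commutator subgroup iff its spinor norm is trivial. -/
theorem mem_commutator_iff (h2 : (2 : k) ≠ 0) (hβ : βᵀ = β) (hdet : IsUnit β.det)
    (he : bil β e e = 0) (hf : bil β f f = 0) (hef : bil β e f = 1) {g : orthGroup β}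
    (hg : (toMat g).det = 1) : g ∈ commutator (orthGroup β) ↔ spinorNorm β g = 1 := by
  constructor
  · intro h
    exact Abelianization.commutator_subset_ker (spinorHom h2 hβ hdet) h
  intro hsp
  have hne : ∀ a : kˣ, bil β (e + (a : k) • f) (e + (a : k) • f) ≠ 0 := fun a => by
    rw [bil_add_smul_self hβ he hf hef]
    exact mul_ne_zero h2 a.ne_zero
  -- `r a` is the common class of all reflections in vectors with `½β(u, u) = a`.
  set r : kˣ → Abelianization (orthGroup β) :=
    fun a => Abelianization.of (reflection hβ (e + (a : k) • f) (hne a)) with hr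
  have hsq : ∀ a, r a * r a = 1 := fun a => abelianization_reflection_mul_self _ _ _
  have hscale : ∀ a c : kˣ, r (a * (c * c)) = r a := by
    intro a c
    have hc : bil β ((c : k) • (e + (a : k) • f)) ((c : k) • (e + (a : k) • f)) ≠ 0 := by
      rw [bil_smul_left, bil_smul_right]
      exact mul_ne_zero c.ne_zero (mul_ne_zero c.ne_zero (hne a))
    have h1 : r (a * (c * c)) = Abelianization.of (reflection hβ _ hc) := by
      refine abelianization_reflection_eq h2 hβ hdet _ _ ?_
      rw [bil_smul_left, bil_smul_right, bil_add_smul_self hβ he hf hef,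
        bil_add_smul_self hβ he hf hef]
      push_cast
      ring
    rw [h1]
    congr 1
    exact toMat_injective (refl_smul c.ne_zero _)
  have hmul : ∀ a b : kˣ, r a * r b = r 1 * r (a * b) := by
    intro a b
    have h1 : r a * r b = r 1 * r (b / a) := by
      rw [hr]
      simp only
      rw [← map_mul, ← map_mul]
      congr 1
      refine toMat_injective (Matrix.ext_of_mulVec_single fun i => ?_)
      rw [toMat_mul, toMat_mul]
      simp only [toMat_reflection, ← mulVec_mulVec]
      rw [refl_mulVec_refl_mulVec h2 hβ he hf hef a.ne_zero b.ne_zero,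
        refl_mulVec_refl_mulVec h2 hβ he hf hef (Units.ne_zero 1) (Units.ne_zero _)]
      simp
    -- The quotient `b / a` and the product `a * b` differ by the square `a * a`.
    rw [h1, ← hscale (b / a) a]
    congr 2
    rw [← mul_assoc, div_mul_cancel, mul_comm]
  obtain ⟨us, hus⟩ := exists_isProdOfReflections h2 hβ hdet g
  -- The exponent is one more than the length so that the empty word gives `r 1 * r 1 = 1`. Each
  -- further reflection is absorbed by `hmul` at the cost of one factor `r 1`.
  have key : ∀ (us : List (ι → k)) (hus : ∀ u ∈ us, bil β u u ≠ 0) (h : orthGroup β),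
      toMat h = (us.map (refl β)).prod → Abelianization.of h =
        r 1 ^ (us.length + 1) * r (Units.mk0 _ (prod_half_bil_ne_zero h2 hus)) := by
    intro us
    induction us with
    | nil =>
      intro hus h hh
      have : h = 1 := toMat_injective (hh.trans rfl)
      rw [this, map_one, List.length_nil, zero_add, pow_one]
      have h1 : Units.mk0 _ (prod_half_bil_ne_zero h2 hus) = 1 := Units.ext (by simp)
      rw [h1, hsq]
    | cons u us ih =>
      intro hus h hh
      have hu := hus u (by simp)
      have hus' : ∀ v ∈ us, bil β v v ≠ 0 := fun v hv => hus v (by simp [hv])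
      obtain ⟨h', hh'⟩ := exists_toMat_eq hdet (Preserves.list_prod_refl hβ hus')
      have hprod : h = reflection hβ u hu * h' :=
        toMat_injective (by rw [hh, toMat_mul, hh', toMat_reflection, List.map_cons,
          List.prod_cons])
      have hru : Abelianization.of (reflection hβ u hu) =
          r (Units.mk0 (bil β u u / 2) (div_ne_zero hu h2)) := by
        refine abelianization_reflection_eq h2 hβ hdet _ _ ?_
        rw [bil_add_smul_self hβ he hf hef, Units.val_mk0, mul_div_cancel₀ _ h2]
      have hq : Units.mk0 _ (prod_half_bil_ne_zero h2 hus) =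
          Units.mk0 (bil β u u / 2) (div_ne_zero hu h2) *
            Units.mk0 _ (prod_half_bil_ne_zero h2 hus') := Units.ext (by simp)
      rw [hprod, map_mul, ih hus' h' hh', hru, mul_left_comm, hmul, hq, List.length_cons,
        pow_succ _ (us.length + 1), mul_assoc]
  -- Each reflection has determinant `-1`, and `-1 ≠ 1` since `2 ≠ 0`.
  have hlen : Even us.length := by
    rw [hus.2, det_prod_refl hus.1] at hg
    have hchar : (-1 : k) ≠ 1 := by
      intro h
      apply h2
      linear_combination -h
    by_contra hodd
    rw [Nat.not_even_iff_odd] at hodd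
    rw [hodd.neg_one_pow] at hg
    exact hchar hg
  rw [spinorNorm_eq (a := Units.mk0 _ (prod_half_bil_ne_zero h2 hus.1)) h2 hβ hdet hus rfl,
    ← sqClass_one, sqClass_eq_sqClass, mul_one] at hsp
  obtain ⟨c, hc⟩ := hsp
  rw [← Abelianization.ker_of, MonoidHom.mem_ker, key us hus.1 g hus.2, hc, ← one_mul (c * c),
    hscale, pow_succ, mul_assoc, hsq, mul_one]
  obtain ⟨j, hj⟩ := hlen
  rw [hj, pow_add, ← mul_pow, hsq, one_pow]

end HyperbolicPair

/-! #### Row and column operations by elements of trivial spinor norm -/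

/-- `x` is the matrix of an orthogonal transformation of spinor norm `c`. -/
def HasSpinorNorm (β x : Matrix ι ι k) (c : SqClass k) : Prop :=
  ∃ y : orthGroup β, toMat y = x ∧ spinorNorm β y = c

theorem HasSpinorNorm.preserves {x : Matrix ι ι k} {c : SqClass k} (h : HasSpinorNorm β x c) :
    Preserves β x := by
  obtain ⟨y, rfl, -⟩ := h
  exact preserves_toMat y

theorem HasSpinorNorm.unique {x : Matrix ι ι k} {c d : SqClass k} (h : HasSpinorNorm β x c)
    (h' : HasSpinorNorm β x d) : c = d := by
  obtain ⟨y, rfl, rfl⟩ := h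
  obtain ⟨y', hy, rfl⟩ := h'
  rw [toMat_injective hy]

theorem HasSpinorNorm.mul (h2 : (2 : k) ≠ 0) (hβ : βᵀ = β) (hdet : IsUnit β.det)
    {x x' : Matrix ι ι k} {c c' : SqClass k} (h : HasSpinorNorm β x c)
    (h' : HasSpinorNorm β x' c') : HasSpinorNorm β (x * x') (c * c') := by
  obtain ⟨y, rfl, rfl⟩ := h
  obtain ⟨y', rfl, rfl⟩ := h'
  exact ⟨y * y', rfl, spinorNorm_mul h2 hβ hdet _ _⟩

theorem hasSpinorNorm_one (h2 : (2 : k) ≠ 0) (hβ : βᵀ = β) (hdet : IsUnit β.det) :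
    HasSpinorNorm β 1 1 :=
  ⟨1, rfl, map_one (spinorHom h2 hβ hdet)⟩

theorem hasSpinorNorm_refl (h2 : (2 : k) ≠ 0) (hβ : βᵀ = β) (hdet : IsUnit β.det) {u : ι → k}
    {c : kˣ} (hu : bil β u u = 2 * c) : HasSpinorNorm β (refl β u) (sqClass c) := by
  have hu' : bil β u u ≠ 0 := by rw [hu]; exact mul_ne_zero h2 c.ne_zero
  refine ⟨reflection hβ u hu', rfl, spinorNorm_eq h2 hβ hdet (us := [u]) ?_ ?_⟩
  · exact ⟨by simpa using hu', by simp [toMat_reflection]⟩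
  · simp [hu, h2]

/-- The invariant behind the algorithm: neither the order nor the choice of operations matters, only
that each factor has trivial norm. -/
theorem HasSpinorNorm.of_ops (h2 : (2 : k) ≠ 0) (hβ : βᵀ = β) (hdet : IsUnit β.det)
    {R C : Set (Matrix ι ι k)} (hR : ∀ x ∈ R, HasSpinorNorm β x 1)
    (hC : ∀ x ∈ C, HasSpinorNorm β x 1) {g h : Matrix ι ι k} (hops : Ops R C g h)
    {c : SqClass k} (hg : HasSpinorNorm β g c) : HasSpinorNorm β h c := by
  induction hops with
  | refl => exact hg
  | tail _ hstep ih =>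
    rcases hstep with ⟨x, hx, rfl⟩ | ⟨x, hx, rfl⟩
    · simpa using (hR x hx).mul h2 hβ hdet ih
    · simpa using ih.mul h2 hβ hdet (hC x hx)

/-- The exponential of `t N`, for `N` with `N ^ 3 = 0` in the Lie algebra of the orthogonal group,
has trivial spinor norm, as it is the square of the exponential of `(t / 2) N`. -/
theorem hasSpinorNorm_exp (h2 : (2 : k) ≠ 0) (hβ : βᵀ = β) (hdet : IsUnit β.det)
    {N : Matrix ι ι k} (hN : β * N = -(Nᵀ * β)) (hN3 : N * N * N = 0) (t : k) :
    HasSpinorNorm β (1 + t • N + (t ^ 2 / 2) • (N * N)) 1 := by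
  set X : k → Matrix ι ι k := fun t => 1 + t • N + (t ^ 2 / 2) • (N * N) with hX
  have hadd : ∀ s t, X s * X t = X (s + t) := by
    intro s t
    have h4 : N * N * (N * N) = 0 := by rw [← mul_assoc, hN3, zero_mul]
    have h3 : N * (N * N) = 0 := by rw [← mul_assoc, hN3]
    simp only [hX, add_mul, mul_add, one_mul, mul_one, smul_mul_assoc, mul_smul_comm, h4, h3, hN3,
      smul_zero, add_zero]
    have : (s + t) ^ 2 / 2 = t ^ 2 / 2 + s * t + s ^ 2 / 2 := by field_simp; ring
    rw [this]
    simp only [add_smul, smul_add, smul_smul]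
    rw [mul_comm t s]
    abel
  have hpres : ∀ t, Preserves β (X t) := by
    intro t
    -- As `N` is skew-adjoint, the adjoint of `X t` is its inverse `X (-t)`.
    have h1 : (X t)ᵀ * β = β * X (-t) := by
      have hNN : (N * N)ᵀ * β = β * (N * N) := by
        rw [transpose_mul, ← mul_assoc, hN, neg_mul, mul_assoc Nᵀ β N, hN, mul_neg, neg_neg,
          mul_assoc]
      simp only [hX, transpose_add, transpose_smul, transpose_one, add_mul, mul_add, one_mul,
        mul_one, smul_mul_assoc, mul_smul_comm, hNN, neg_sq, neg_smul, mul_neg, hN, smul_neg,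
        neg_neg]
    rw [Preserves, h1, mul_assoc, hadd, neg_add_cancel]
    simp [hX]
  obtain ⟨y, hy⟩ := exists_toMat_eq hdet (hpres (t / 2))
  have h : HasSpinorNorm β (X (t / 2)) (spinorNorm β y) := ⟨y, hy, rfl⟩
  have := h.mul h2 hβ hdet h
  rwa [mul_self_eq_one, hadd, show t / 2 + t / 2 = t by field_simp; ring] at this

end General

/-! ### The spinor norms of the elementary matrices -/

section Elementary

variable {ι k : Type*} [Fintype ι] [DecidableEq ι] [Field k] {l : ℕ}

/-- The indices `p i`, `n i` span mutually orthogonal hyperbolic planes of the form `β`. -/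
structure IsSplit (β : Matrix ι ι k) (p n : Fin l → ι) : Prop where
  two_ne_zero : (2 : k) ≠ 0
  symm : βᵀ = β
  isUnit_det : IsUnit β.det
  injective_pos : Function.Injective p
  injective_neg : Function.Injective n
  pos_ne_neg : ∀ i j, p i ≠ n j
  apply_pos : ∀ a i, β a (p i) = if a = n i then 1 else 0
  apply_neg : ∀ a i, β a (n i) = if a = p i then 1 else 0

/-- The index `z` is orthogonal to all others and has length `2`. -/
structure IsMiddle (β : Matrix ι ι k) (z : ι) (p n : Fin l → ι) : Prop where
  ne_pos : ∀ i, z ≠ p i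
  ne_neg : ∀ i, z ≠ n i
  apply_self : ∀ a, β a z = if a = z then 2 else 0

theorem mul_single_of_apply_eq {β : Matrix ι ι k} {a b : ι} {w : k}
    (h : ∀ c, β c a = if c = b then w else 0) (d : ι) (x : k) :
    β * single a d x = single b d (w * x) := by
  ext i j
  by_cases hj : j = d
  · subst hj
    rw [mul_single_apply_same, h]
    by_cases hi : i = b
    · simp [hi]
    · rw [single_apply_of_ne _ _ _ _ _ (fun hh => hi hh.1.symm)]; simp [hi]
  · rw [mul_single_apply_of_ne _ _ _ _ _ hj, single_apply_of_ne _ _ _ _ _ (fun hh => hj hh.2.symm)]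

theorem single_mul_of_apply_eq {β : Matrix ι ι k} (hβ : βᵀ = β) {a b : ι} {w : k}
    (h : ∀ c, β c a = if c = b then w else 0) (d : ι) (x : k) :
    single d a x * β = single d b (w * x) := by
  rw [← transpose_inj, transpose_mul, hβ, transpose_single, mul_single_of_apply_eq h,
    transpose_single]

namespace IsSplit

variable {β : Matrix ι ι k} {p n : Fin l → ι}

/-- The symmetry between positive and negative indices. It exchanges types 2 and 3, and the two
families of type 4. -/
theorem swap (hs : IsSplit β p n) : IsSplit β n p where
  two_ne_zero := hs.two_ne_zero
  symm := hs.symm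
  isUnit_det := hs.isUnit_det
  injective_pos := hs.injective_neg
  injective_neg := hs.injective_pos
  pos_ne_neg i j := (hs.pos_ne_neg j i).symm
  apply_pos := hs.apply_neg
  apply_neg := hs.apply_pos

theorem mul_single_pos (hs : IsSplit β p n) (i : Fin l) (d : ι) (x : k) :
    β * single (p i) d x = single (n i) d x := by
  rw [mul_single_of_apply_eq fun c => hs.apply_pos c i, one_mul]

theorem single_pos_mul (hs : IsSplit β p n) (i : Fin l) (d : ι) (x : k) :
    single d (p i) x * β = single d (n i) x := by
  rw [single_mul_of_apply_eq hs.symm fun c => hs.apply_pos c i, one_mul]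

theorem hasSpinorNorm_of_sq_eq_zero (hs : IsSplit β p n) {N : Matrix ι ι k}
    (hN : β * N = -(Nᵀ * β)) (hN2 : N * N = 0) (t : k) : HasSpinorNorm β (1 + t • N) 1 := by
  have := hasSpinorNorm_exp hs.two_ne_zero hs.symm hs.isUnit_det hN (by rw [hN2, zero_mul]) t
  simpa [hN2] using this

theorem hasSpinorNorm_of_mem_E1 (hs : IsSplit β p n) {x : Matrix ι ι k} (hx : x ∈ E1 k p n) :
    HasSpinorNorm β x 1 := by
  obtain ⟨i, j, t, hij, rfl⟩ := hx
  apply hs.hasSpinorNorm_of_sq_eq_zero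
  · simp only [mul_sub, sub_mul, transpose_sub, transpose_single, hs.mul_single_pos,
      hs.swap.mul_single_pos, hs.single_pos_mul, hs.swap.single_pos_mul]
    abel
  · simp [mul_sub, sub_mul, hs.injective_pos.eq_iff,
      hs.injective_neg.eq_iff, hij, hij.symm, hs.pos_ne_neg, (hs.pos_ne_neg _ _).symm]

theorem hasSpinorNorm_of_mem_E2 (hs : IsSplit β p n) {x : Matrix ι ι k} (hx : x ∈ E2 k p n) :
    HasSpinorNorm β x 1 := by
  obtain ⟨i, j, t, hij, rfl⟩ := hx
  apply hs.hasSpinorNorm_of_sq_eq_zero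
  · simp only [mul_sub, sub_mul, transpose_sub, transpose_single, hs.mul_single_pos,
      hs.single_pos_mul]
    abel
  · simp [mul_sub, sub_mul, (hs.pos_ne_neg _ _).symm]

theorem hasSpinorNorm_of_mem_E3 (hs : IsSplit β p n) {x : Matrix ι ι k} (hx : x ∈ E3 k p n) :
    HasSpinorNorm β x 1 := hs.swap.hasSpinorNorm_of_mem_E2 hx

/-- For `N = 2 e_{i,0} - e_{0,-i}` one has `N² = -2 e_{i,-i}` and `N³ = 0`, so `x_{i,0}(t)` is
exactly the exponential of `t N`. -/
theorem hasSpinorNorm_of_mem_E4 (hs : IsSplit β p n) {z : ι} (hz : IsMiddle β z p n)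
    {x : Matrix ι ι k} (hx : x ∈ E4 k z p n) : HasSpinorNorm β x 1 := by
  have key : ∀ {p n : Fin l → ι} (_ : IsSplit β p n) (_ : IsMiddle β z p n) (i : Fin l) (t : k),
      HasSpinorNorm β (1 + t • ((2 : k) • single (p i) z 1 - single z (n i) 1) -
        t ^ 2 • single (p i) (n i) 1) 1 := by
    intro p n hs hz i t
    set N : Matrix ι ι k := (2 : k) • single (p i) z 1 - single z (n i) 1 with hN
    have hNN : N * N = -((2 : k) • single (p i) (n i) 1) := by
      simp [hN, mul_sub, sub_mul, hz.ne_pos, (hz.ne_neg _).symm,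
        (hs.pos_ne_neg _ _).symm]
    have h := hasSpinorNorm_exp hs.two_ne_zero hs.symm hs.isUnit_det (N := N) ?_ ?_ t
    · convert h using 1
      rw [hNN, smul_neg, smul_smul, div_mul_cancel₀ _ hs.two_ne_zero, sub_eq_add_neg]
    · simp only [hN, mul_sub, sub_mul, transpose_sub, transpose_single, hs.mul_single_pos,
        hs.single_pos_mul, mul_single_of_apply_eq hz.apply_self,
        single_mul_of_apply_eq hs.symm hz.apply_self, smul_single, smul_eq_mul]
      abel
    · rw [hNN]
      simp [hN, mul_sub, (hz.ne_neg _).symm, (hs.pos_ne_neg _ _).symm]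
  obtain ⟨i, t, rfl | rfl⟩ := hx
  · exact key hs hz i t
  -- With the signs of the indices exchanged, `x_{0,i}(t)` is the first family at parameter `-t`.
  · have h := key hs.swap ⟨hz.ne_neg, hz.ne_pos, hz.apply_self⟩ i (-t)
    convert h using 2
    · rw [neg_smul, ← smul_neg t, neg_sub, neg_add_eq_sub]
    · rw [neg_sq]

theorem bil_single_left (hβ : βᵀ = β) {a b : ι} {w : k}
    (h : ∀ c, β c a = if c = b then w else 0) (x : ι → k) :
    bil β (Pi.single a 1) x = w * x b := by
  rw [bil, single_one_dotProduct, mulVec, dotProduct, Finset.sum_eq_single b]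
  · rw [← hβ, transpose_apply, h, if_pos rfl]
  · intro c _ hc
    rw [← hβ, transpose_apply, h, if_neg hc, zero_mul]
  · simp

theorem bil_pos (hs : IsSplit β p n) (i : Fin l) (x : ι → k) :
    bil β (Pi.single (p i) 1) x = x (n i) := by
  rw [bil_single_left hs.symm fun c => hs.apply_pos c i, one_mul]

theorem bil_pos_pos (hs : IsSplit β p n) (i : Fin l) :
    bil β (Pi.single (p i) 1) (Pi.single (p i) 1) = 0 := by
  rw [hs.bil_pos, Pi.single_eq_of_ne (hs.pos_ne_neg i i).symm]

theorem bil_pos_neg (hs : IsSplit β p n) (i : Fin l) :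
    bil β (Pi.single (p i) 1) (Pi.single (n i) 1) = 1 := by
  rw [hs.bil_pos, Pi.single_eq_same]

theorem mem_commutator_iff (hs : IsSplit β p n) (i : Fin l) {g : orthGroup β}
    (hg : (toMat g).det = 1) : g ∈ commutator (orthGroup β) ↔ spinorNorm β g = 1 :=
  SplitOrth.mem_commutator_iff hs.two_ne_zero hs.symm hs.isUnit_det (hs.bil_pos_pos i)
    (hs.swap.bil_pos_pos i) (hs.bil_pos_neg i) hg

/-- The two vectors have half-lengths `1` and `c`. By `diagonal_eq_refl_mul_refl` this computes the
spinor norm of `diag(c, c⁻¹)` on a hyperbolic plane. -/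
theorem hasSpinorNorm_refl_mul_refl (hs : IsSplit β p n) (i : Fin l) (c : kˣ) :
    HasSpinorNorm β (refl β (Pi.single (p i) 1 + (1 : k) • Pi.single (n i) 1) *
      refl β (Pi.single (p i) 1 + (c : k) • Pi.single (n i) 1)) (sqClass c) := by
  have h : ∀ c : kˣ, HasSpinorNorm β (refl β (Pi.single (p i) 1 + (c : k) • Pi.single (n i) 1))
      (sqClass c) := fun c => hasSpinorNorm_refl hs.two_ne_zero hs.symm hs.isUnit_det
    (bil_add_smul_self hs.symm (hs.bil_pos_pos i) (hs.swap.bil_pos_pos i) (hs.bil_pos_neg i) _)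
  have := (h 1).mul hs.two_ne_zero hs.symm hs.isUnit_det (h c)
  simpa [sqClass_one] using this

theorem diagonal_eq_refl_mul_refl (hs : IsSplit β p n) (i : Fin l) (c : kˣ) :
    diagonal (fun a => if a = p i then (c : k) else if a = n i then (c : k)⁻¹ else 1) =
      refl β (Pi.single (p i) 1 + (1 : k) • Pi.single (n i) 1) *
      refl β (Pi.single (p i) 1 + (c : k) • Pi.single (n i) 1) := by
  refine Matrix.ext_of_mulVec_single fun j => ?_
  rw [← mulVec_mulVec, refl_mulVec_refl_mulVec hs.two_ne_zero hs.symm (hs.bil_pos_pos i)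
    (hs.swap.bil_pos_pos i) (hs.bil_pos_neg i) one_ne_zero c.ne_zero, hs.bil_pos,
    hs.swap.bil_pos]
  generalize (Pi.single j 1 : ι → k) = x
  ext a
  rw [mulVec_diagonal]
  simp only [Pi.add_apply, Pi.smul_apply, Pi.single_apply, smul_eq_mul]
  by_cases h1 : a = p i
  · subst h1
    simp [hs.pos_ne_neg]
    ring
  · by_cases h2 : a = n i
    · subst h2
      simp [(hs.pos_ne_neg _ _).symm]
      ring
    · simp [h1, h2]

/-- Reflection in `e_i + e_{-i}`, a vector of half-length `1`, sends `e_i` to `-e_{-i}`. -/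
theorem wMat_eq_refl (hs : IsSplit β p n) (i : Fin l) :
    wMat k p n i = refl β (Pi.single (p i) 1 + (1 : k) • Pi.single (n i) 1) := by
  refine Matrix.ext_of_mulVec_single fun j => ?_
  rw [refl_mulVec, bil_add_smul_self hs.symm (hs.bil_pos_pos i) (hs.swap.bil_pos_pos i)
    (hs.bil_pos_neg i), bil_add_left, bil_smul_left, hs.bil_pos, hs.swap.bil_pos, mul_one,
    mul_div_cancel_left₀ _ hs.two_ne_zero]
  generalize (Pi.single j 1 : ι → k) = x
  simp only [wMat, sub_mulVec, one_mulVec, single_mulVec]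
  ext a
  simp only [Pi.sub_apply, Function.update_apply, Pi.zero_apply, one_mul, Pi.smul_apply,
    Pi.add_apply, Pi.single_apply, smul_eq_mul]
  by_cases h1 : a = p i
  · subst h1
    simp [hs.pos_ne_neg]
  · by_cases h2 : a = n i
    · subst h2
      simp [(hs.pos_ne_neg _ _).symm]
    · simp [h1, h2]

theorem hasSpinorNorm_wMat (hs : IsSplit β p n) (i : Fin l) :
    HasSpinorNorm β (wMat k p n i) 1 := by
  rw [hs.wMat_eq_refl, ← sqClass_one]
  refine hasSpinorNorm_refl hs.two_ne_zero hs.symm hs.isUnit_det ?_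
  rw [bil_add_smul_self hs.symm (hs.bil_pos_pos i) (hs.swap.bil_pos_pos i) (hs.bil_pos_neg i)]
  simp

/-- This is the reflection in `e_0`. The entry `2` of the form at index `0` is what makes its
half-length `1`. -/
theorem hasSpinorNorm_middle (hs : IsSplit β p n) {z : ι} (hz : IsMiddle β z p n) :
    HasSpinorNorm β (1 - (2 : k) • single z z 1) 1 := by
  have hb : bil β (Pi.single z 1) (Pi.single z 1) = 2 := by
    rw [bil_single_left hs.symm hz.apply_self]
    simp
  have h : (1 - (2 : k) • single z z 1 : Matrix ι ι k) = refl β (Pi.single z 1) := by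
    refine Matrix.ext_of_mulVec_single fun j => ?_
    rw [refl_mulVec, hb, bil_single_left hs.symm hz.apply_self]
    generalize (Pi.single j 1 : ι → k) = x
    rw [sub_mulVec, one_mulVec, smul_mulVec, single_mulVec, mul_div_cancel_left₀ _ hs.two_ne_zero]
    ext a
    simp [Function.update_apply, Pi.single_apply]
  rw [h, ← sqClass_one]
  refine hasSpinorNorm_refl hs.two_ne_zero hs.symm hs.isUnit_det ?_
  rw [hb]
  simp

theorem hasSpinorNorm_list_prod (hs : IsSplit β p n) {α : Type*} (L : List α)
    {f : α → Matrix ι ι k} (hf : ∀ a, HasSpinorNorm β (f a) 1) :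
    HasSpinorNorm β (L.map f).prod 1 := by
  induction L with
  | nil => exact hasSpinorNorm_one hs.two_ne_zero hs.symm hs.isUnit_det
  | cons a L ih =>
    rw [List.map_cons, List.prod_cons]
    simpa using (hf a).mul hs.two_ne_zero hs.symm hs.isUnit_det ih

end IsSplit

end Elementary

/-! ### The split forms -/

section Forms

variable {k : Type*} [Field k] {l : ℕ}

theorem isSplit_evenForm (h2 : (2 : k) ≠ 0) : IsSplit (evenForm l k) ep en where
  two_ne_zero := h2
  symm := by simp [evenForm, fromBlocks_transpose]
  isUnit_det := Matrix.isUnit_det_of_right_inverse (B := evenForm l k) (by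
    simp [evenForm, fromBlocks_multiply])
  injective_pos := Sum.inl_injective
  injective_neg := Sum.inr_injective
  pos_ne_neg _ _ := Sum.inl_ne_inr
  apply_pos a i := by rcases a with a | a <;> simp [evenForm, ep, en, one_apply]
  apply_neg a i := by rcases a with a | a <;> simp [evenForm, ep, en, one_apply]

theorem isSplit_oddForm (h2 : (2 : k) ≠ 0) : IsSplit (oddForm l k) op on where
  two_ne_zero := h2
  symm := by simp [oddForm, fromBlocks_transpose]
  isUnit_det := Matrix.isUnit_det_of_right_inverse
    (B := fromBlocks (diagonal fun _ => 2⁻¹) 0 0 (fromBlocks 0 1 1 0)) (by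
    simp [oddForm, fromBlocks_multiply, h2])
  injective_pos := Sum.inr_injective.comp Sum.inl_injective
  injective_neg := Sum.inr_injective.comp Sum.inr_injective
  pos_ne_neg _ _ := by simp [op, on]
  apply_pos a i := by rcases a with a | a | a <;> simp [oddForm, op, on, one_apply]
  apply_neg a i := by rcases a with a | a | a <;> simp [oddForm, op, on, one_apply]

theorem isMiddle_oddForm : IsMiddle (oddForm l k) oz op on where
  ne_pos _ := by simp [oz, op]
  ne_neg _ := by simp [oz, on]
  apply_self a := by rcases a with a | a | a <;> simp [oddForm, oz]

theorem hasSpinorNorm_evenDiag (h2 : (2 : k) ≠ 0) (hl : 1 ≤ l) (c : kˣ) :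
    HasSpinorNorm (evenForm l k) (evenDiag l c) (sqClass c) := by
  have hs := isSplit_evenForm (l := l) h2
  let i : Fin l := ⟨l - 1, by omega⟩
  convert hs.hasSpinorNorm_refl_mul_refl i c using 1
  rw [← hs.diagonal_eq_refl_mul_refl, evenDiag, diagLam, diagLam, fromBlocks_diagonal]
  congr 1
  ext a
  have hi : ∀ a : Fin l, (a : ℕ) + 1 = l ↔ a = i := fun a => by
    rw [Fin.ext_iff]; simp only [i]; omega
  rcases a with a | a <;> simp [ep, en, hi]

theorem hasSpinorNorm_oddDiag_one (h2 : (2 : k) ≠ 0) (hl : 1 ≤ l) (c : kˣ) :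
    HasSpinorNorm (oddForm l k) (oddDiag l 1 c) (sqClass c) := by
  have hs := isSplit_oddForm (l := l) h2
  let i : Fin l := ⟨l - 1, by omega⟩
  convert hs.hasSpinorNorm_refl_mul_refl i c using 1
  rw [← hs.diagonal_eq_refl_mul_refl, oddDiag, oddBlock, diagLam, diagLam, fromBlocks_diagonal,
    fromBlocks_diagonal]
  congr 1
  ext a
  have hi : ∀ a : Fin l, (a : ℕ) + 1 = l ↔ a = i := fun a => by
    rw [Fin.ext_iff]; simp only [i]; omega
  rcases a with a | a | a <;> simp [op, on, hi]

/-- Preservation of the length of `e_0` forces `α² = 1`, and `α = -1` contributes only a reflection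
of trivial norm. -/
theorem hasSpinorNorm_oddDiag (h2 : (2 : k) ≠ 0) (hl : 1 ≤ l) {a : k} {c : kˣ}
    (hp : Preserves (oddForm l k) (oddDiag l a c)) :
    HasSpinorNorm (oddForm l k) (oddDiag l a c) (sqClass c) := by
  have hs := isSplit_oddForm (l := l) h2
  have ha : a = 1 ∨ a = -1 := by
    have h := congrFun (congrFun (show _ = _ from hp) oz) oz
    have : a * 2 * a = 2 := by
      simpa [oddDiag, oddBlock, oddForm, fromBlocks_transpose, fromBlocks_multiply, oz] using h
    have h3 : a * a = 1 := mul_left_cancel₀ h2 (by linear_combination this)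
    exact mul_self_eq_one_iff.mp h3
  rcases ha with rfl | rfl
  · exact hasSpinorNorm_oddDiag_one h2 hl c
  · have h := (hs.hasSpinorNorm_middle isMiddle_oddForm).mul h2 hs.symm hs.isUnit_det
      (hasSpinorNorm_oddDiag_one h2 hl c)
    rw [one_mul] at h
    convert h using 1
    have h1 : (1 - (2 : k) • single oz oz 1 : Matrix (OddIdx l) (OddIdx l) k) =
        fromBlocks (diagonal fun _ => -1) 0 0 1 := by
      ext a b
      rcases a with a | a <;> rcases b with b | b <;>
        simp [oz, one_apply]
      norm_num
    rw [h1, oddDiag, oddDiag, oddBlock, oddBlock, fromBlocks_multiply]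
    simp

end Forms

/-! ### Normal forms under multiplication by matrices of determinant one -/

section NormalForm

variable {k : Type*} [Field k]

open Matrix.SpecialLinearGroup in
-- The classical identity `h(a) = w(a) w(-1)` in `SL₂`, where `w(a) = x(a) y(-a⁻¹) x(a)` with `x`,
-- `y` the upper and lower transvections.
theorem diag2n_eq_prod_transvection {ι : Type*} [Fintype ι] [DecidableEq ι] {i j : ι} (hij : i ≠ j)
    {a : k} (ha : a ≠ 0) :
    diag2n hij a ha = SpecialLinearGroup.transvection hij a *
      SpecialLinearGroup.transvection hij.symm (-a⁻¹) * SpecialLinearGroup.transvection hij a *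
      (SpecialLinearGroup.transvection hij (-1) * SpecialLinearGroup.transvection hij.symm 1 *
        SpecialLinearGroup.transvection hij (-1)) := by
  refine Subtype.ext ?_
  simp only [coe_mul, transvection_coe, diag2n_coe, mul_add, add_mul, one_mul, mul_one,
    single_mul_single_of_ne _ _ _ _ hij, single_mul_single_of_ne _ _ _ _ hij.symm,
    single_mul_single_same, add_zero]
  ext x y
  have h := mul_inv_cancel₀ ha
  simp only [diagonal_apply, Matrix.add_apply, single_apply, one_apply]
  grind

/-- The special linear group over a field is generated by the transvections. -/
theorem specialLinearGroup_induction {ι : Type*} [Fintype ι] [DecidableEq ι]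
    {P : SpecialLinearGroup ι k → Prop} (hone : P 1)
    (htransvec : ∀ (i j : ι) (hij : i ≠ j) (a : k), P (SpecialLinearGroup.transvection hij a))
    (hmul : ∀ A B, P A → P B → P (A * B)) (M : SpecialLinearGroup ι k) : P M := by
  rcases subsingleton_or_nontrivial ι with h | h
  · have : M = 1 := by
      refine Subtype.ext (Matrix.ext fun i j => ?_)
      have hM := M.2
      have : Unique ι := ⟨⟨i⟩, fun a => Subsingleton.elim _ _⟩
      rw [det_unique] at hM
      rw [Subsingleton.elim i default, Subsingleton.elim j default, hM]
      simp
    rw [this]; exact hone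
  · refine SpecialLinearGroup.diagonal_transvection_induction' P M (fun i j hij c hc => ?_)
      htransvec hmul
    rw [diag2n_eq_prod_transvection]
    exact hmul _ _ (hmul _ _ (hmul _ _ (htransvec ..) (htransvec ..)) (htransvec ..))
      (hmul _ _ (hmul _ _ (htransvec ..) (htransvec ..)) (htransvec ..))

variable {l : ℕ}

theorem det_diagLam (hl : 1 ≤ l) (c : k) : (diagLam l c).det = c := by
  rw [diagLam, det_diagonal, Finset.prod_eq_single ⟨l - 1, by omega⟩]
  · simp; omega
  · intro i _ hi
    rw [if_neg]
    intro h
    exact hi (Fin.ext (by simp only; omega))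
  · simp

/-- The last diagonal entry of the singular normal form is `0`, so a factor there is invisible; it
serves to correct determinants to `1`. -/
theorem diagLam_mul_diagRank {m : ℕ} (hm : m < l) (c : k) :
    diagLam l c * diagRank k l m = diagRank k l m := by
  rw [diagLam, diagRank, diagonal_mul_diagonal]
  congr 1
  ext i
  split_ifs <;> first | omega | simp

theorem diagRank_mul_diagLam {m : ℕ} (hm : m < l) (c : k) :
    diagRank k l m * diagLam l c = diagRank k l m := by
  rw [diagLam, diagRank, diagonal_mul_diagonal]
  congr 1
  ext i
  split_ifs <;> first | omega | simp

theorem diagRank_self : diagRank k l l = 1 := by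
  rw [diagRank, ← diagonal_one]
  congr 1
  ext i
  simp

theorem exists_mul_eq_diagLam (hl : 1 ≤ l) {A : Matrix (Fin l) (Fin l) k} (hA : A.det ≠ 0) :
    ∃ (P : SpecialLinearGroup (Fin l) k) (c : kˣ), (P : Matrix _ _ k) * A = diagLam l (c : k) := by
  have hu : IsUnit A.det := IsUnit.mk0 _ hA
  -- This `P` has determinant `1`, so row operations alone suffice when `A` is invertible.
  refine ⟨⟨diagLam l A.det * A⁻¹, ?_⟩, Units.mk0 _ hA, ?_⟩
  · rw [det_mul, det_diagLam hl, mul_comm, det_nonsing_inv_mul_det _ hu]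
  · simp [nonsing_inv_mul_cancel_right _ _ hu]

/-- The rank normal form gives invertible factors; rescaling one row and one column by inverse
determinants puts them in `SL_l` without changing the result, as the rank is less than `l`. -/
theorem exists_mul_mul_eq_diagRank {A : Matrix (Fin l) (Fin l) k} (hA : A.det = 0) :
    ∃ P Q : SpecialLinearGroup (Fin l) k, ∃ m < l,
      (P : Matrix _ _ k) * A * (Q : Matrix _ _ k) = diagRank k l m := by
  obtain ⟨V, U, e, hV, hU, hVU⟩ := exists_rank_normal_form A
  have hr : A.rank ≤ l := by simpa using A.rank_le_width
  let e' : Fin A.rank ⊕ Fin (Fintype.card (Fin l) - A.rank) ≃ Fin l :=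
    finSumFinEquiv.trans (finCongr (by rw [Fintype.card_fin]; omega))
  -- The normal form places its ones in an unspecified order; `σ` moves them to the front.
  let σ : Fin l ≃ Fin l := e'.symm.trans e.symm
  have hVU' : V.submatrix σ id * A * U.submatrix id σ = diagRank k l A.rank := by
    have : V.submatrix σ id * A * U.submatrix id σ = (V * A * U).submatrix σ σ := by
      rw [← submatrix_mul_equiv (V * A) U σ (Equiv.refl _) σ,
        ← submatrix_mul_equiv V A σ (Equiv.refl _) (Equiv.refl _)]
      rfl
    rw [this, hVU, submatrix_submatrix, ← diagonal_one, ← diagonal_zero, fromBlocks_diagonal,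
      diagRank]
    have hσ : e ∘ σ = e'.symm := by ext i; simp [σ]
    rw [hσ, submatrix_diagonal_equiv]
    congr 1
    ext i
    obtain ⟨j, rfl⟩ := e'.surjective i
    rcases j with j | j <;> simp [e']
  have hV' : IsUnit (V.submatrix σ id) := (isUnit_submatrix_equiv σ (Equiv.refl _)).mpr hV
  have hU' : IsUnit (U.submatrix id σ) := (isUnit_submatrix_equiv (Equiv.refl _) σ).mpr hU
  generalize V.submatrix σ id = V' at *
  generalize U.submatrix id σ = U' at *
  have hVd := (isUnit_iff_isUnit_det _).mp hV'
  have hUd := (isUnit_iff_isUnit_det _).mp hU'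
  have hm : A.rank < l := by
    refine lt_of_le_of_ne hr fun h => ?_
    rw [h, diagRank_self] at hVU'
    have := congrArg det hVU'
    simp [det_mul, hA] at this
  have hl : 1 ≤ l := by omega
  refine ⟨⟨diagLam l (V'.det)⁻¹ * V', ?_⟩, ⟨U' * diagLam l (U'.det)⁻¹, ?_⟩, A.rank, hm, ?_⟩
  · rw [det_mul, det_diagLam hl, inv_mul_cancel₀ hVd.ne_zero]
  · rw [det_mul, det_diagLam hl, mul_inv_cancel₀ hUd.ne_zero]
  · calc _ = diagLam l (V'.det)⁻¹ * (V' * A * U') * diagLam l (U'.det)⁻¹ := by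
          simp only [Matrix.mul_assoc]
      _ = _ := by rw [hVU', diagLam_mul_diagRank hm, diagRank_mul_diagLam hm]

end NormalForm

/-! ### Row and column operations on the blocks -/

section Operations

section

variable {ι k : Type*} [Fintype ι] [Field k]

theorem Ops.trans {R C : Set (Matrix ι ι k)} {g h j : Matrix ι ι k} (h₁ : Ops R C g h)
    (h₂ : Ops R C h j) : Ops R C g j := Relation.ReflTransGen.trans h₁ h₂

theorem Ops.refl {R C : Set (Matrix ι ι k)} (g : Matrix ι ι k) : Ops R C g g :=
  Relation.ReflTransGen.refl

theorem Ops.row {R C : Set (Matrix ι ι k)} {x : Matrix ι ι k} (hx : x ∈ R) (g : Matrix ι ι k) :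
    Ops R C g (x * g) := Relation.ReflTransGen.single (Or.inl ⟨x, hx, rfl⟩)

theorem Ops.col {R C : Set (Matrix ι ι k)} {x : Matrix ι ι k} (hx : x ∈ C) (g : Matrix ι ι k) :
    Ops R C g (g * x) := Relation.ReflTransGen.single (Or.inr ⟨x, hx, rfl⟩)

end

section

variable {ι k : Type*} [Field k] {l : ℕ}

section

variable [DecidableEq ι]

theorem mem_E1 {p n : Fin l → ι} {i j : Fin l} (hij : i ≠ j) (t : k) :
    1 + t • (single (p i) (p j) 1 - single (n j) (n i) 1) ∈ E1 k p n := ⟨i, j, t, hij, rfl⟩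

theorem mem_E3 {p n : Fin l → ι} {i j : Fin l} (hij : i < j) (t : k) :
    1 + t • (single (n i) (p j) 1 - single (n j) (p i) 1) ∈ E3 k p n := ⟨i, j, t, hij, rfl⟩

theorem pos_mem_E4 {z : ι} {p n : Fin l → ι} (i : Fin l) (t : k) :
    1 + t • ((2 : k) • single (p i) z 1 - single z (n i) 1) - t ^ 2 • single (p i) (n i) 1 ∈
      E4 k z p n := ⟨i, t, Or.inl rfl⟩

theorem neg_mem_E4 {z : ι} {p n : Fin l → ι} (i : Fin l) (t : k) :
    1 + t • (-((2 : k) • single (n i) z 1) + single z (p i) 1) - t ^ 2 • single (n i) (p i) 1 ∈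
      E4 k z p n := ⟨i, t, Or.inr rfl⟩

end

/-- If the rows `n i` of `g` vanish on the columns `p j`, then so do those of `h`, and the same holds
for each row that is none of the `p i`, `n i`. -/
def KeepsZeros (p n : Fin l → ι) (g h : Matrix ι ι k) : Prop :=
  (blockC p n g = 0 → blockC p n h = 0) ∧
    ∀ z, (∀ i, z ≠ p i) → (∀ i, z ≠ n i) → (∀ i, g z (p i) = 0) → ∀ i, h z (p i) = 0

theorem KeepsZeros.trans {p n : Fin l → ι} {g h j : Matrix ι ι k} (h₁ : KeepsZeros p n g h)
    (h₂ : KeepsZeros p n h j) : KeepsZeros p n g j :=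
  ⟨fun hg => h₂.1 (h₁.1 hg), fun z hp hn hg => h₂.2 z hp hn (h₁.2 z hp hn hg)⟩

theorem KeepsZeros.refl (p n : Fin l → ι) (g : Matrix ι ι k) : KeepsZeros p n g g :=
  ⟨id, fun _ _ _ h => h⟩

end

variable {ι k : Type*} [Fintype ι] [DecidableEq ι] [Field k] {l : ℕ}

theorem single_mul_apply_eq_ite {κ : Type*} (a b c : ι) (d : κ) (x : k) (g : Matrix ι κ k) :
    (single a b x * g) c d = if c = a then x * g b d else 0 := by
  split_ifs with h
  · subst h; rw [single_mul_apply_same]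
  · rw [single_mul_apply_of_ne _ _ _ _ _ h]

theorem mul_single_apply_eq_ite {κ : Type*} (a b d : ι) (c : κ) (x : k) (g : Matrix κ ι k) :
    (g * single a b x) c d = if d = b then g c a * x else 0 := by
  split_ifs with h
  · subst h; rw [mul_single_apply_same]
  · rw [mul_single_apply_of_ne _ _ _ _ _ h]

/-! ### Block operations realized by elementary matrices -/

namespace IsSplit

variable {β : Matrix ι ι k} {p n : Fin l → ι}

/-- On the rows `p`, `x_{i,j}(t)` is a transvection, and these generate `SL_l`. Its other term
combines rows `n` among themselves, so zeros of `C` and of a middle row survive for use after the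
interchange. -/
theorem exists_ops_mul_blockA (hs : IsSplit β p n) (P : SpecialLinearGroup (Fin l) k) :
    ∀ g : Matrix ι ι k, ∃ h, Ops (E1 k p n) (E1 k p n) g h ∧
      blockA p h = (P : Matrix _ _ k) * blockA p g ∧ KeepsZeros p n g h := by
  induction P using specialLinearGroup_induction with
  | hone => exact fun g => ⟨g, .refl g, by simp, .refl p n g⟩
  | htransvec i j hij t =>
    intro g
    refine ⟨_, .row (mem_E1 hij t) g, ?_, ?_, ?_⟩
    · ext a b
      rw [SpecialLinearGroup.transvection_coe, add_mul, one_mul]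
      simp only [blockA, submatrix_apply, add_mul, one_mul, smul_mul_assoc, sub_mul,
        Matrix.add_apply, Matrix.smul_apply, Matrix.sub_apply, single_mul_apply_eq_ite,
        hs.injective_pos.eq_iff, hs.pos_ne_neg, if_false, smul_eq_mul, sub_zero, mul_ite, mul_zero]
    · intro hC
      have hC' : ∀ a b, g (n a) (p b) = 0 := fun a b => congrFun (congrFun hC a) b
      ext a b
      simp [blockC, add_mul, sub_mul, single_mul_apply_eq_ite, hC', (hs.pos_ne_neg _ _).symm]
    · intro z hzp hzn hz b
      simp [add_mul, sub_mul, hz, hzp, hzn]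
  | hmul A B hA hB =>
    intro g
    obtain ⟨h, hops, hblock, hkeep⟩ := hB g
    obtain ⟨h', hops', hblock', hkeep'⟩ := hA h
    exact ⟨h', hops.trans hops', hblock'.trans (by rw [hblock, ← mul_assoc]; rfl),
      hkeep.trans hkeep'⟩

theorem exists_ops_blockA_mul (hs : IsSplit β p n) (P : SpecialLinearGroup (Fin l) k) :
    ∀ g : Matrix ι ι k, ∃ h, Ops (E1 k p n) (E1 k p n) g h ∧
      blockA p h = blockA p g * (P : Matrix _ _ k) ∧ KeepsZeros p n g h := by
  induction P using specialLinearGroup_induction with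
  | hone => exact fun g => ⟨g, .refl g, by simp, .refl p n g⟩
  | htransvec i j hij t =>
    intro g
    refine ⟨_, .col (mem_E1 hij t) g, ?_, ?_, ?_⟩
    · ext a b
      rw [SpecialLinearGroup.transvection_coe, mul_add, mul_one]
      simp only [blockA, submatrix_apply, mul_add, mul_one, mul_smul_comm, mul_sub,
        Matrix.add_apply, Matrix.smul_apply, Matrix.sub_apply, mul_single_apply_eq_ite,
        hs.injective_pos.eq_iff, hs.pos_ne_neg, if_false, smul_eq_mul, sub_zero, mul_ite, mul_zero]
      simp [mul_comm]
    · intro hC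
      have hC' : ∀ a b, g (n a) (p b) = 0 := fun a b => congrFun (congrFun hC a) b
      ext a b
      simp [blockC, mul_add, mul_sub, mul_single_apply_eq_ite, hC', hs.pos_ne_neg]
    · intro z hzp hzn hz b
      simp [mul_add, mul_sub, mul_single_apply_eq_ite, hz, hs.pos_ne_neg]
  | hmul A B hA hB =>
    intro g
    obtain ⟨h, hops, hblock, hkeep⟩ := hA g
    obtain ⟨h', hops', hblock', hkeep'⟩ := hB h
    exact ⟨h', hops.trans hops', hblock'.trans (by rw [hblock, mul_assoc]; rfl),
      hkeep.trans hkeep'⟩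

theorem exists_ops_blockA_eq_diagLam (hs : IsSplit β p n) (hl : 1 ≤ l) {g : Matrix ι ι k}
    (hg : (blockA p g).det ≠ 0) :
    ∃ (c : kˣ) (h : Matrix ι ι k), Ops (E1 k p n) (E1 k p n) g h ∧
      blockA p h = diagLam l (c : k) ∧ KeepsZeros p n g h := by
  obtain ⟨P, c, hP⟩ := exists_mul_eq_diagLam hl hg
  obtain ⟨h, hops, hblock, hkeep⟩ := hs.exists_ops_mul_blockA P g
  exact ⟨c, h, hops, hblock.trans hP, hkeep⟩

theorem exists_ops_blockA_normal (hs : IsSplit β p n) (hl : 1 ≤ l) (g : Matrix ι ι k) :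
    ∃ h, Ops (E1 k p n) (E1 k p n) g h ∧ ((∃ c : kˣ, blockA p h = diagLam l (c : k)) ∨
      ∃ m < l, blockA p h = diagRank k l m) := by
  by_cases hg : (blockA p g).det = 0
  · obtain ⟨P, Q, m, hm, hPQ⟩ := exists_mul_mul_eq_diagRank hg
    obtain ⟨h, hops, hblock, -⟩ := hs.exists_ops_mul_blockA P g
    obtain ⟨h', hops', hblock', -⟩ := hs.exists_ops_blockA_mul Q h
    exact ⟨h', hops.trans hops', Or.inr ⟨m, hm, by rw [hblock', hblock, hPQ]⟩⟩
  · obtain ⟨c, h, hops, hblock, -⟩ := hs.exists_ops_blockA_eq_diagLam hl hg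
    exact ⟨h, hops, Or.inl ⟨c, hblock⟩⟩

/-- `T` times the rows `p j` can be added to the rows `n i` if `T` is alternating. -/
theorem exists_ops_add_mul_rows (hs : IsSplit β p n) {T : Matrix (Fin l) (Fin l) k}
    (hT : Tᵀ = -T) : ∀ g : Matrix ι ι k, ∃ h, Ops (E3 k p n) ∅ g h ∧
      h.submatrix n id = g.submatrix n id + T * g.submatrix p id ∧
      ∀ a, (∀ i, a ≠ n i) → h a = g a := by
  set U : Matrix (Fin l) (Fin l) k → Prop := fun T => ∀ g : Matrix ι ι k, ∃ h,
    Ops (E3 k p n) ∅ g h ∧ h.submatrix n id = g.submatrix n id + T * g.submatrix p id ∧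
      ∀ a, (∀ i, a ≠ n i) → h a = g a with hU
  have hzero : U 0 := fun g => ⟨g, .refl g, by simp, fun _ _ => rfl⟩
  -- Type 3 operations leave the rows `p` alone, so successive additions accumulate; it is enough to
  -- treat the elementary alternating matrices.
  have hadd : ∀ S T, U S → U T → U (S + T) := by
    intro S T hS hT g
    obtain ⟨h, hops, hn, hrow⟩ := hS g
    obtain ⟨h', hops', hn', hrow'⟩ := hT h
    have hp : h.submatrix p id = g.submatrix p id := by
      ext i b
      exact congrFun (hrow (p i) fun j => hs.pos_ne_neg i j) b
    refine ⟨h', hops.trans hops', ?_, fun a ha => (hrow' a ha).trans (hrow a ha)⟩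
    rw [hn', hp, hn, Matrix.add_mul, add_assoc]
  have hsingle : ∀ (i j : Fin l) (t : k), i < j → U (t • (single i j 1 - single j i 1)) := by
    intro i j t hij g
    refine ⟨_, .row (mem_E3 hij t) g, ?_, ?_⟩
    · ext a b
      simp only [submatrix_apply, id_eq, add_mul, one_mul, smul_mul_assoc, sub_mul,
        Matrix.add_apply, Matrix.smul_apply, Matrix.sub_apply, single_mul_apply_eq_ite,
        hs.injective_neg.eq_iff, Matrix.smul_mul, Matrix.sub_mul]
    · intro a ha
      ext b
      simp [add_mul, sub_mul, ha]
  have hsum : T = ∑ i, ∑ j, if i < j then T i j • (single i j 1 - single j i 1) else 0 := by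
    have hterm : ∀ a b i j : Fin l, (if i < j then T i j • (single i j 1 - single j i 1) else 0 :
        Matrix (Fin l) (Fin l) k) a b = (if j = b then if i = a then
          if a < b then T a b else 0 else 0 else 0) +
          if j = a then if i = b then if b < a then -T b a else 0 else 0 else 0 := by
      clear_value U
      clear hU hT hzero hadd hsingle
      intro a b i j
      by_cases hij : i < j
      · simp only [hij, if_true, Matrix.smul_apply, Matrix.sub_apply, single_apply, smul_eq_mul]
        grind
      · simp only [hij, if_false, Matrix.zero_apply]
        grind
    have hT' : ∀ i j, T j i = -T i j := fun i j => congrFun (congrFun hT i) j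
    -- Skew-symmetry implies alternating because `2 ≠ 0`.
    have hdiag : ∀ i, T i i = 0 := fun i => by
      have h : (2 : k) * T i i = 0 := by linear_combination hT' i i
      exact (mul_eq_zero.mp h).resolve_left hs.two_ne_zero
    ext a b
    simp only [Matrix.sum_apply, hterm, Finset.sum_add_distrib, Finset.sum_ite_eq',
      Finset.mem_univ, if_true]
    rcases lt_trichotomy a b with h | h | h
    · simp [h, h.not_gt]
    · subst h; simp [hdiag]
    · simp [h, h.not_gt, hT' b a]
  change U T
  rw [hsum]
  refine Finset.sum_induction _ U hadd hzero fun i _ =>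
    Finset.sum_induction _ U hadd hzero fun j _ => ?_
  split_ifs with hij
  · exact hsingle i j _ hij
  · exact hzero

theorem exists_ops_clear_row (hs : IsSplit β p n) {z : ι} (hz : IsMiddle β z p n)
    {g : Matrix ι ι k} {d : Fin l → k} (hA : blockA p g = diagonal d) (s : Finset (Fin l))
    (hd : ∀ i ∈ s, d i ≠ 0) :
    ∃ h, Ops (E4 k z p n) (E4 k z p n) g h ∧ (∀ i, h (p i) = g (p i)) ∧
      ∀ i ∈ s, h z (p i) = 0 := by
  induction s using Finset.induction_on with
  | empty => exact ⟨g, .refl g, fun _ => rfl, by simp⟩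
  | insert i s hi ih =>
    obtain ⟨h, hops, hp, hzero⟩ := ih fun j hj => hd j (Finset.mem_insert_of_mem hj)
    have hA' : ∀ a b, h (p a) (p b) = if a = b then d a else 0 := fun a b => by
      rw [hp, ← diagonal_apply, ← hA]; rfl
    -- The multiple of row `p i` that cancels the entry in row `z`. Since `A` is diagonal, the
    -- entries in the other columns `p j` are unaffected.
    refine ⟨_, hops.trans (.row (neg_mem_E4 i (-(h z (p i) / d i))) h), fun j => ?_, fun j hj => ?_⟩
    · ext b
      simp [add_mul, sub_mul, hs.pos_ne_neg, (hz.ne_pos _).symm, hp]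
    · simp only [add_mul, sub_mul, one_mul, smul_mul_assoc, neg_mul, Matrix.add_apply,
        Matrix.sub_apply, Matrix.smul_apply, Matrix.neg_apply, single_mul_apply_eq_ite, hz.ne_neg,
        if_false, if_true, smul_eq_mul, mul_zero, neg_zero, zero_add, sub_zero, hA']
      rcases Finset.mem_insert.mp hj with rfl | hj'
      · have := hd j (Finset.mem_insert_self _ _)
        simp [this]
      · have : i ≠ j := by rintro rfl; exact hi hj'
        rw [hzero j hj', if_neg this]
        simp

theorem exists_ops_clear_col (hs : IsSplit β p n) {z : ι} (hz : IsMiddle β z p n)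
    {g : Matrix ι ι k} {d : Fin l → k} (hA : blockA p g = diagonal d) (s : Finset (Fin l))
    (hd : ∀ i ∈ s, d i ≠ 0) :
    ∃ h, Ops (E4 k z p n) (E4 k z p n) g h ∧ (∀ a i, h a (p i) = g a (p i)) ∧
      ∀ i ∈ s, h (p i) z = 0 := by
  induction s using Finset.induction_on with
  | empty => exact ⟨g, .refl g, fun _ _ => rfl, by simp⟩
  | insert i s hi ih =>
    obtain ⟨h, hops, hp, hzero⟩ := ih fun j hj => hd j (Finset.mem_insert_of_mem hj)
    have hA' : ∀ a b, h (p a) (p b) = if a = b then d a else 0 := fun a b => by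
      rw [hp, ← diagonal_apply, ← hA]; rfl
    -- The extra division by `2` compensates the coefficient `2` of `e_{i,0}`.
    refine ⟨_, hops.trans (.col (pos_mem_E4 i (-(h (p i) z / d i / 2))) h), fun a j => ?_,
      fun j hj => ?_⟩
    · simp [mul_add, mul_sub, hs.pos_ne_neg, (hz.ne_pos _).symm, hp]
    · simp only [mul_add, mul_sub, mul_one, mul_smul_comm, Matrix.add_apply,
        Matrix.sub_apply, Matrix.smul_apply, mul_single_apply_eq_ite, hz.ne_neg,
        if_false, if_true, smul_eq_mul, mul_zero, sub_zero, hA']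
      rcases Finset.mem_insert.mp hj with rfl | hj'
      · have := hd j (Finset.mem_insert_self _ _)
        have h2 := hs.two_ne_zero
        rw [if_pos rfl]
        field_simp
        ring
      · have : j ≠ i := by rintro rfl; exact hi hj'
        rw [hzero j hj', if_neg this]
        simp

/-- The row is cleared before the column: clearing the column leaves the columns `p` untouched,
hence keeps `A` and the zeros of the row. -/
theorem exists_ops_clear (hs : IsSplit β p n) {z : ι} (hz : IsMiddle β z p n)
    {g : Matrix ι ι k} {d : Fin l → k} (hA : blockA p g = diagonal d) (s : Finset (Fin l))
    (hd : ∀ i ∈ s, d i ≠ 0) :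
    ∃ h, Ops (E4 k z p n) (E4 k z p n) g h ∧ blockA p h = diagonal d ∧
      ∀ i ∈ s, h z (p i) = 0 ∧ h (p i) z = 0 := by
  obtain ⟨h, hops, hp, hzero⟩ := hs.exists_ops_clear_row hz hA s hd
  have hA' : blockA p h = diagonal d := by
    rw [← hA]; ext i j; simp [blockA, hp]
  obtain ⟨h', hops', hp', hzero'⟩ := hs.exists_ops_clear_col hz hA' s hd
  refine ⟨h', hops.trans hops', ?_, fun i hi => ⟨by rw [hp', hzero i hi], hzero' i hi⟩⟩
  rw [← hA']; ext i j; simp [blockA, hp']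

end IsSplit

/-- `f i` interchanges the rows `p i` and `n i` up to sign, and multiplies the row `z` by a
constant. -/
structure IsInterchange (p n : Fin l → ι) (f : Fin l → Matrix ι ι k) : Prop where
  apply_pos : ∀ i (g : Matrix ι ι k), (f i * g) (p i) = -g (n i)
  apply_neg : ∀ i (g : Matrix ι ι k), (f i * g) (n i) = -g (p i)
  apply_pos_of_ne : ∀ i j (g : Matrix ι ι k), j ≠ i → (f i * g) (p j) = g (p j)
  apply_neg_of_ne : ∀ i j (g : Matrix ι ι k), j ≠ i → (f i * g) (n j) = g (n j)
  apply_other : ∀ i (g : Matrix ι ι k) (z : ι), (∀ j, z ≠ p j) → (∀ j, z ≠ n j) →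
    ∃ c : k, (f i * g) z = c • g z

theorem IsInterchange.list_prod {p n : Fin l → ι} {f : Fin l → Matrix ι ι k}
    (hf : IsInterchange p n f) {L : List (Fin l)} (hL : L.Nodup) (g : Matrix ι ι k) :
    (∀ i, ((L.map f).prod * g) (p i) = if i ∈ L then -g (n i) else g (p i)) ∧
    (∀ i, ((L.map f).prod * g) (n i) = if i ∈ L then -g (p i) else g (n i)) ∧
    ∀ z, (∀ j, z ≠ p j) → (∀ j, z ≠ n j) → ∃ c : k, ((L.map f).prod * g) z = c • g z := by
  induction L with
  | nil => exact ⟨by simp, by simp, fun z _ _ => ⟨1, by simp⟩⟩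
  | cons a L ih =>
    obtain ⟨ha, hL⟩ := List.nodup_cons.mp hL
    obtain ⟨h1, h2, h3⟩ := ih hL
    simp only [List.map_cons, List.prod_cons, mul_assoc]
    refine ⟨fun i => ?_, fun i => ?_, fun z hp hn => ?_⟩
    · by_cases hi : i = a
      · subst hi; rw [hf.apply_pos, h2]; simp [ha]
      · rw [hf.apply_pos_of_ne _ _ _ hi, h1]; simp [hi]
    · by_cases hi : i = a
      · subst hi; rw [hf.apply_neg, h1]; simp [ha]
      · rw [hf.apply_neg_of_ne _ _ _ hi, h2]; simp [hi]
    · obtain ⟨c, hc⟩ := h3 z hp hn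
      obtain ⟨c', hc'⟩ := hf.apply_other a ((L.map f).prod * g) z hp hn
      exact ⟨c' * c, by rw [hc', hc, smul_smul]⟩

theorem IsSplit.isInterchange_wMat {β : Matrix ι ι k} {p n : Fin l → ι} (hs : IsSplit β p n) :
    IsInterchange p n (wMat k p n) where
  apply_pos i g := by
    ext b
    simp [wMat, sub_mul, hs.pos_ne_neg]
  apply_neg i g := by
    ext b
    simp [wMat, sub_mul, (hs.pos_ne_neg _ _).symm]
  apply_pos_of_ne i j g h := by
    ext b
    simp [wMat, sub_mul, hs.pos_ne_neg, hs.injective_pos.eq_iff, h]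
  apply_neg_of_ne i j g h := by
    ext b
    simp [wMat, sub_mul, (hs.pos_ne_neg _ _).symm,
      hs.injective_neg.eq_iff, h]
  apply_other i g z hp hn := ⟨1, by
    ext b
    simp [wMat, sub_mul, hp, hn]⟩

theorem IsSplit.isInterchange_wMat_sub {β : Matrix ι ι k} {p n : Fin l → ι} (hs : IsSplit β p n)
    {z : ι} (hz : IsMiddle β z p n) :
    IsInterchange p n (fun i => wMat k p n i - (2 : k) • single z z 1) where
  apply_pos i g := by
    ext b
    simp [sub_mul, hs.isInterchange_wMat.apply_pos, (hz.ne_pos _).symm]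
  apply_neg i g := by
    ext b
    simp [sub_mul, hs.isInterchange_wMat.apply_neg, (hz.ne_neg _).symm]
  apply_pos_of_ne i j g h := by
    ext b
    simp [sub_mul, hs.isInterchange_wMat.apply_pos_of_ne _ _ _ h,
      (hz.ne_pos _).symm]
  apply_neg_of_ne i j g h := by
    ext b
    simp [sub_mul, hs.isInterchange_wMat.apply_neg_of_ne _ _ _ h,
      (hz.ne_neg _).symm]
  apply_other i g y hp hn := by
    obtain ⟨c, hc⟩ := hs.isInterchange_wMat.apply_other i g y hp hn
    refine ⟨c - if y = z then 2 else 0, ?_⟩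
    ext b
    have := congrFun hc b
    by_cases h : y = z
    · subst h; simp [sub_mul] at this ⊢; rw [this]
    · simp [sub_mul, h] at this ⊢; rw [this]

end Operations

/-! ### The elimination algorithm -/

section Relations

variable {ι k : Type*} [Fintype ι] [DecidableEq ι] [Field k] {l : ℕ}

/-- `ζ` is the coordinate along the part of the space that is orthogonal to the hyperbolic planes
of the indices `p i`, `n i`. -/
def HasCoords {ι k : Type*} [Fintype ι] [Field k] {l : ℕ} (β : Matrix ι ι k) (p n : Fin l → ι)
    (ζ : (ι → k) → k) : Prop :=
  ∀ u v, bil β u v = 2 * ζ u * ζ v + ∑ i, (u (p i) * v (n i) + u (n i) * v (p i))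

theorem HasCoords.swap {ι k : Type*} [Fintype ι] [Field k] {l : ℕ} {β : Matrix ι ι k}
    {p n : Fin l → ι} {ζ : (ι → k) → k} (hc : HasCoords β p n ζ) : HasCoords β n p ζ := by
  intro u v
  rw [hc]
  simp only [add_comm]

variable {β : Matrix ι ι k} {p n : Fin l → ι} {ζ : (ι → k) → k}

theorem HasCoords.apply_eq (hc : HasCoords β p n ζ) {g : Matrix ι ι k} (hg : Preserves β g)
    (a b : ι) :
    2 * ζ (g.col a) * ζ (g.col b) + ∑ i, (g (p i) a * g (n i) b + g (n i) a * g (p i) b) =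
      β a b := by
  have h := preserves_iff_bil.mp hg (Pi.single a 1) (Pi.single b 1)
  rw [hc] at h
  simpa [bil] using h

/-- Pairing the columns `p i` and `p j` of `g`. Where `X` vanishes and `d` is nonzero, the relation
says that `C` divided columnwise by `d` is skew-symmetric. -/
theorem HasCoords.blockC_relation (hs : IsSplit β p n) (hc : HasCoords β p n ζ)
    {g : Matrix ι ι k} (hg : Preserves β g) {d : Fin l → k} (hA : blockA p g = diagonal d)
    (i j : Fin l) : 2 * ζ (g.col (p i)) * ζ (g.col (p j)) +
      (d i * g (n i) (p j) + d j * g (n j) (p i)) = 0 := by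
  have hA' : ∀ a b, g (p a) (p b) = if a = b then d a else 0 := fun a b => by
    rw [← diagonal_apply, ← hA]; rfl
  have h := hc.apply_eq hg (p i) (p j)
  rw [hs.apply_pos, if_neg (hs.pos_ne_neg i j)] at h
  simpa [hA', Finset.sum_add_distrib, mul_comm (g _ _)] using h

theorem HasCoords.transpose_blockA_mul (hs : IsSplit β p n) (hc : HasCoords β p n ζ)
    {g : Matrix ι ι k} (hg : Preserves β g) (hC : blockC p n g = 0)
    (hX : ∀ i, ζ (g.col (p i)) = 0) : (blockA p g)ᵀ * blockA n g = 1 := by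
  have hC' : ∀ a b, g (n a) (p b) = 0 := fun a b => congrFun (congrFun hC a) b
  ext i j
  have h := hc.apply_eq hg (p i) (n j)
  rw [hs.apply_neg] at h
  simpa [hX, hC', Matrix.mul_apply, blockA, one_apply, hs.injective_pos.eq_iff] using h

/-- The block `C` can be made zero as far as the diagonal block `A` is invertible. -/
theorem HasCoords.exists_ops_clear_blockC (hs : IsSplit β p n) (hc : HasCoords β p n ζ)
    {g : Matrix ι ι k} (hg : Preserves β g) {d : Fin l → k} (hA : blockA p g = diagonal d)
    (hX : ∀ i, d i ≠ 0 → ζ (g.col (p i)) = 0) :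
    ∃ h, Ops (E3 k p n) ∅ g h ∧ (∀ a, (∀ i, a ≠ n i) → h a = g a) ∧
      (∀ b, (∀ i, g (p i) b = 0) → ∀ i, h (n i) b = g (n i) b) ∧
      ∀ i j, d i ≠ 0 → d j ≠ 0 → blockC p n h i j = 0 := by
  classical
  -- `T` solves `C + T A = 0` on the invertible part of `A` and is zero elsewhere, which keeps it
  -- skew-symmetric.
  set T : Matrix (Fin l) (Fin l) k :=
    of fun i j => if d i ≠ 0 ∧ d j ≠ 0 then -(g (n i) (p j) / d j) else 0 with hTdef
  have hT : Tᵀ = -T := by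
    ext i j
    by_cases hij : d i ≠ 0 ∧ d j ≠ 0
    · have h := hc.blockC_relation hs hg hA i j
      rw [hX i hij.1] at h
      obtain ⟨hi, hj⟩ := hij
      simp only [hTdef, transpose_apply, of_apply, Matrix.neg_apply, hi, hj, ne_eq,
        not_false_eq_true, and_self, if_true]
      field_simp
      linear_combination -h
    · have hji : ¬(d j ≠ 0 ∧ d i ≠ 0) := fun h => hij h.symm
      simp only [hTdef, transpose_apply, of_apply, Matrix.neg_apply, hij, hji, if_false, neg_zero]
  obtain ⟨h, hops, hrow, hother⟩ := hs.exists_ops_add_mul_rows hT g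
  refine ⟨h, hops, hother, fun b hb i => ?_, fun i j hi hj => ?_⟩
  · have hib := congrFun (congrFun hrow i) b
    simpa [Matrix.mul_apply, hb] using hib
  have hA' : ∀ a b, g (p a) (p b) = if a = b then d a else 0 := fun a b => by
    rw [← diagonal_apply, ← hA]; rfl
  have hij := congrFun (congrFun hrow i) (p j)
  simp only [submatrix_apply, id_eq, Matrix.add_apply, Matrix.mul_apply, hA', mul_ite, mul_zero,
    Finset.sum_ite_eq', Finset.mem_univ, if_true] at hij
  rw [blockC, submatrix_apply, hij, hTdef, of_apply, if_pos ⟨hi, hj⟩]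
  field_simp
  ring

/-- If `A` is `diag(1, …, 1, 0, …, 0)` with `m` ones, then interchanging the rows `p i` and `n i` for
`i ≥ m` makes the block `C` zero. -/
theorem HasCoords.interchange (hs : IsSplit β p n) (hc : HasCoords β p n ζ)
    {g : Matrix ι ι k} (hg : Preserves β g) {m : ℕ} (hA : blockA p g = diagRank k l m)
    (hX : ∀ i : Fin l, (i : ℕ) < m → ζ (g.col (p i)) = 0)
    (hC : ∀ i j : Fin l, (i : ℕ) < m → (j : ℕ) < m → blockC p n g i j = 0)
    {f : Fin l → Matrix ι ι k} (hf : IsInterchange p n f) :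
    (∀ i, ζ (g.col (p i)) = 0) ∧
      blockC p n ((((List.finRange l).filter fun i : Fin l => m ≤ (i : ℕ)).map f).prod * g) = 0 := by
  have hrel := hc.blockC_relation hs hg hA
  have hX' : ∀ i, ζ (g.col (p i)) = 0 := by
    intro i
    by_cases hi : (i : ℕ) < m
    · exact hX i hi
    -- For `i ≥ m` the diagonal relation reads `2 ζ² = 0`, so the rest of `X` vanishes by itself.
    · have h := hrel i i
      simp only [hi, if_false, zero_mul, add_zero] at h
      rcases mul_eq_zero.mp h with h | h
      · exact (mul_eq_zero.mp h).resolve_left hs.two_ne_zero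
      · exact h
  refine ⟨hX', ?_⟩
  obtain ⟨-, hn, -⟩ := hf.list_prod
    ((List.nodup_finRange l).filter fun i : Fin l => decide (m ≤ (i : ℕ))) g
  ext i j
  rw [blockC, submatrix_apply, hn]
  -- For `i < m ≤ j` the relation has `d_i = 1` and `d_j = 0`, so it reads `C_{ij} = 0`. For `i ≥ m`
  -- the new row of `C` is minus a zero row of `A`.
  by_cases hi : (i : ℕ) < m
  · rw [if_neg (by simpa using hi)]
    by_cases hj : (j : ℕ) < m
    · exact hC i j hi hj
    · have h := hrel i j
      simpa [hX', hi, hj] using h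
  · rw [if_pos (by simpa using hi)]
    have h := congrFun (congrFun hA i) j
    simp only [blockA, submatrix_apply, diagRank, diagonal_apply, hi, if_false, ite_self] at h
    simp [h]

end Relations

/-! ### Existence of runs, and spinor norms of their outputs -/

section Outputs

variable {k : Type*} [Field k] {l : ℕ}

/-- With `ζ = 0` the even case obeys the same relations as the odd one. -/
theorem hasCoords_evenForm : HasCoords (evenForm l k) ep en fun _ => 0 := by
  intro u v
  simp [bil, evenForm, dotProduct, Fintype.sum_sum_type, mulVec, one_apply, ep, en,
    Finset.sum_add_distrib]

theorem hasCoords_oddForm : HasCoords (oddForm l k) op on fun u => u oz := by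
  intro u v
  simp [bil, oddForm, dotProduct, Fintype.sum_sum_type, mulVec, one_apply, op, on, oz,
    Finset.sum_add_distrib]
  ring

theorem diagLam_ne_zero (c : kˣ) (i : Fin l) : (if (i : ℕ) + 1 = l then (c : k) else 1) ≠ 0 := by
  split_ifs
  · exact c.ne_zero
  · exact one_ne_zero

theorem diagLam_mul_diagLam_inv (c : kˣ) :
    diagLam l (c : k) * diagLam l ((c⁻¹ : kˣ) : k) = 1 := by
  rw [diagLam, diagLam, diagonal_mul_diagonal, ← diagonal_one]
  congr 1
  ext i
  split_ifs <;> simp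

theorem eq_diagLam_inv {c : kˣ} {D : Matrix (Fin l) (Fin l) k}
    (h : (diagLam l (c : k))ᵀ * D = 1) : D = diagLam l ((c⁻¹ : kˣ) : k) := by
  rw [diagLam, diagonal_transpose, ← diagLam] at h
  calc D = diagLam l ((c⁻¹ : kˣ) : k) * diagLam l (c : k) * D := by
        rw [mul_eq_one_comm.mp (diagLam_mul_diagLam_inv c), Matrix.one_mul]
    _ = _ := by rw [mul_assoc, h, mul_one]

/-! #### Even dimension -/

theorem exists_eq_fromBlocks_even (h2 : (2 : k) ≠ 0) {g : Matrix (EvenIdx l) (EvenIdx l) k}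
    (hg : Preserves (evenForm l k) g) {c : kˣ} (hA : blockA ep g = diagLam l (c : k))
    (hC : blockC ep en g = 0) :
    ∃ B, g = fromBlocks (diagLam l (c : k)) B 0 (diagLam l ((c⁻¹ : kˣ) : k)) := by
  have hD := hasCoords_evenForm.transpose_blockA_mul (isSplit_evenForm h2) hg hC fun _ => rfl
  rw [hA] at hD
  refine ⟨g.toBlocks₁₂, ?_⟩
  rw [← eq_diagLam_inv hD, ← hA, ← hC]
  exact (fromBlocks_toBlocks g).symm

/-- Exchanging positive and negative indices turns clearing `B` by type 2 into clearing `C` by type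
3, with `diag(1, …, 1, λ⁻¹)` as the pivot block. -/
theorem evenStep3_of_eq (h2 : (2 : k) ≠ 0) {g : Matrix (EvenIdx l) (EvenIdx l) k}
    (hg : Preserves (evenForm l k) g) {c : kˣ} {B : Matrix (Fin l) (Fin l) k}
    (hB : g = fromBlocks (diagLam l (c : k)) B 0 (diagLam l ((c⁻¹ : kˣ) : k))) :
    EvenStep3 g c := by
  obtain ⟨h, hops, hrow, hcol, hzero⟩ := hasCoords_evenForm.swap.exists_ops_clear_blockC
    (isSplit_evenForm h2).swap hg (d := fun i => if (i : ℕ) + 1 = l then ((c⁻¹ : kˣ) : k) else 1)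
    (by rw [hB]; rfl) fun _ _ => rfl
  have : h = evenDiag l c := by
    ext a b
    rcases a with a | a
    · rcases b with b | b
      · refine (hcol (Sum.inl b) (fun i => by rw [hB]; rfl) a).trans ?_
        rw [hB]; rfl
      · exact hzero a b (diagLam_ne_zero _ _) (diagLam_ne_zero _ _)
    · rw [hrow (Sum.inr a) (by simp [ep]), hB]
      rfl
  rw [EvenStep3, ← this]
  exact hops

theorem Preserves.of_ops {ι : Type*} [Fintype ι] [DecidableEq ι] {β : Matrix ι ι k}
    {p n : Fin l → ι} (hs : IsSplit β p n) {R C : Set (Matrix ι ι k)}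
    (hR : ∀ x ∈ R, HasSpinorNorm β x 1) (hC : ∀ x ∈ C, HasSpinorNorm β x 1) {g h : Matrix ι ι k}
    (hops : Ops R C g h) (hg : Preserves β g) : Preserves β h := by
  obtain ⟨g', rfl⟩ := exists_toMat_eq hs.isUnit_det hg
  exact (HasSpinorNorm.of_ops hs.two_ne_zero hs.symm hs.isUnit_det hR hC hops
    ⟨g', rfl, rfl⟩).preserves

theorem hasSpinorNorm_evenSwap (h2 : (2 : k) ≠ 0) (m : ℕ) :
    HasSpinorNorm (evenForm l k) (evenSwap k l m) 1 :=
  (isSplit_evenForm h2).hasSpinorNorm_list_prod _ (isSplit_evenForm h2).hasSpinorNorm_wMat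

theorem hasSpinorNorm_oddSwap (h2 : (2 : k) ≠ 0) (m : ℕ) :
    HasSpinorNorm (oddForm l k) (oddSwap k l m) 1 := by
  have hs := isSplit_oddForm (l := l) h2
  refine hs.hasSpinorNorm_list_prod _ fun i => ?_
  have h := (hs.hasSpinorNorm_middle isMiddle_oddForm).mul h2 hs.symm hs.isUnit_det
    (hs.hasSpinorNorm_wMat i)
  rw [one_mul] at h
  convert h using 1
  rw [sub_mul, one_mul, smul_mul_assoc]
  congr 2
  ext a b
  rw [single_mul_apply_eq_ite, single_apply]
  have hz := isMiddle_oddForm (l := l) (k := k)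
  by_cases ha : a = oz
  · subst ha
    simp [wMat, (hz.ne_pos i).symm, (hz.ne_neg i).symm, one_apply]
  · simp [ha, Ne.symm ha]

theorem exists_evenOutputs (h2 : (2 : k) ≠ 0) (hl : 1 ≤ l)
    (g : orthGroup (evenForm l k)) : ∃ c : kˣ, EvenOutputs (toMat g) c := by
  have hs := isSplit_evenForm (l := l) h2
  have hc := hasCoords_evenForm (l := l) (k := k)
  have hE1 : ∀ x ∈ E1 k ep en, HasSpinorNorm (evenForm l k) x 1 :=
    fun _ => hs.hasSpinorNorm_of_mem_E1
  have hE3 : ∀ x ∈ E3 k ep en, HasSpinorNorm (evenForm l k) x 1 :=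
    fun _ => hs.hasSpinorNorm_of_mem_E3
  obtain ⟨g₁, hops₁, hform⟩ := hs.exists_ops_blockA_normal hl (toMat g)
  have hg₁ := Preserves.of_ops hs hE1 hE1 hops₁ (preserves_toMat g)
  suffices h : ∃ g₂, EvenStep2 g₁ g₂ ∧ Preserves (evenForm l k) g₂ by
    obtain ⟨g₂, hstep, hg₂⟩ := h
    obtain ⟨-, c, B, hB⟩ := id hstep
    exact ⟨c, g₁, g₂, ⟨hops₁, hform⟩, hstep, evenStep3_of_eq h2 hg₂ hB⟩
  rcases hform with ⟨c, hA⟩ | ⟨m, hm, hA⟩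
  · obtain ⟨g₂, hops₂, hrow, -, hzero⟩ := hc.exists_ops_clear_blockC hs hg₁ hA fun _ _ => rfl
    have hg₂ := Preserves.of_ops hs hE3 (by simp) hops₂ hg₁
    have hA₂ : blockA ep g₂ = diagLam l (c : k) := by
      rw [← hA]
      ext i j
      exact congrFun (hrow _ fun j => hs.pos_ne_neg i j) _
    obtain ⟨B, hB⟩ := exists_eq_fromBlocks_even h2 hg₂ hA₂ (Matrix.ext fun i j =>
      hzero i j (diagLam_ne_zero c i) (diagLam_ne_zero c j))
    exact ⟨g₂, ⟨Or.inl ⟨⟨c, hA⟩, hops₂⟩, c, B, hB⟩, hg₂⟩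
  · obtain ⟨h, hops, hrow, -, hzero⟩ := hc.exists_ops_clear_blockC hs hg₁ hA fun _ _ => rfl
    have hh := Preserves.of_ops hs hE3 (by simp) hops hg₁
    have hAh : blockA ep h = diagRank k l m := by
      rw [← hA]
      ext i j
      exact congrFun (hrow _ fun j => hs.pos_ne_neg i j) _
    have hCh : ∀ i j : Fin l, (i : ℕ) < m → (j : ℕ) < m → blockC ep en h i j = 0 :=
      fun i j hi hj => hzero i j (by simp [hi]) (by simp [hj])
    obtain ⟨-, hCw⟩ := hc.interchange hs hh hAh (fun _ _ => rfl) hCh hs.isInterchange_wMat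
    have hw : Preserves (evenForm l k) (evenSwap k l m * h) :=
      (hasSpinorNorm_evenSwap h2 m).preserves.mul hh
    -- Once `C = 0`, the relation `ᵗA D = 1` makes `A` invertible.
    have hdet : (blockA ep (evenSwap k l m * h)).det ≠ 0 := by
      have := congrArg det (hc.transpose_blockA_mul hs hw hCw fun _ => rfl)
      rw [det_mul, det_transpose, det_one] at this
      exact left_ne_zero_of_mul_eq_one this
    obtain ⟨c, g₂, hops₂, hA₂, hkeep⟩ := hs.exists_ops_blockA_eq_diagLam hl hdet
    have hg₂ := Preserves.of_ops hs hE1 hE1 hops₂ hw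
    obtain ⟨B, hB⟩ := exists_eq_fromBlocks_even h2 hg₂ hA₂ (hkeep.1 hCw)
    exact ⟨g₂, ⟨Or.inr ⟨m, hm, hA, h, hops, hCh, hops₂⟩, c, B, hB⟩, hg₂⟩

theorem EvenOutputs.hasSpinorNorm (h2 : (2 : k) ≠ 0) {g : Matrix (EvenIdx l) (EvenIdx l) k}
    {c : kˣ} {x : SqClass k} (hg : HasSpinorNorm (evenForm l k) g x) (h : EvenOutputs g c) :
    HasSpinorNorm (evenForm l k) (evenDiag l c) x := by
  have hs := isSplit_evenForm (l := l) h2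
  have hE1 : ∀ x ∈ E1 k ep en, HasSpinorNorm (evenForm l k) x 1 :=
    fun _ => hs.hasSpinorNorm_of_mem_E1
  have hE2 : ∀ x ∈ E2 k ep en, HasSpinorNorm (evenForm l k) x 1 :=
    fun _ => hs.hasSpinorNorm_of_mem_E2
  have hE3 : ∀ x ∈ E3 k ep en, HasSpinorNorm (evenForm l k) x 1 :=
    fun _ => hs.hasSpinorNorm_of_mem_E3
  have hstep := @HasSpinorNorm.of_ops _ k _ _ _ _ h2 hs.symm hs.isUnit_det
  obtain ⟨g₁, g₂, ⟨h₁, -⟩, ⟨h₂, -⟩, h₃⟩ := h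
  have hg₁ := hstep hE1 hE1 h₁ hg
  refine hstep hE2 (by simp) h₃ ?_
  rcases h₂ with ⟨-, h₂⟩ | ⟨m, -, -, h, h₂, -, h₂'⟩
  · exact hstep hE3 (by simp) h₂ hg₁
  · refine hstep hE1 hE1 h₂' ?_
    simpa using (hasSpinorNorm_evenSwap h2 m).mul h2 hs.symm hs.isUnit_det
      (hstep hE3 (by simp) h₂ hg₁)

theorem EvenReduces.hasSpinorNorm (h2 : (2 : k) ≠ 0) {g : Matrix (EvenIdx l) (EvenIdx l) k}
    {c : kˣ} {x : SqClass k} (hg : HasSpinorNorm (evenForm l k) g x) (h : EvenReduces g c) :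
    HasSpinorNorm (evenForm l k) (evenDiag l c) x := by
  have hs := isSplit_evenForm (l := l) h2
  have hE : ∀ x ∈ EvenElem l k, HasSpinorNorm (evenForm l k) x 1 := by
    rintro x (((hx | hx) | hx) | ⟨i, -, rfl⟩)
    exacts [hs.hasSpinorNorm_of_mem_E1 hx, hs.hasSpinorNorm_of_mem_E2 hx,
      hs.hasSpinorNorm_of_mem_E3 hx, hs.hasSpinorNorm_wMat i]
  exact HasSpinorNorm.of_ops h2 hs.symm hs.isUnit_det hE hE h hg

/-! #### Odd dimension -/

/-- Pairings of columns remove what is left: `p i` with `0` gives zeros below in column `0`, then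
`0` with itself gives `α ≠ 0`, and then `0` with `-i` gives zeros in row `0`. -/
theorem exists_eq_oddBlock (h2 : (2 : k) ≠ 0) {g : Matrix (OddIdx l) (OddIdx l) k}
    (hg : Preserves (oddForm l k) g) {c : kˣ} (hA : blockA op g = diagLam l (c : k))
    (hC : blockC op on g = 0) (hXE : XEZero l g) :
    ∃ a B, g = oddBlock a (diagLam l (c : k)) B (diagLam l ((c⁻¹ : kˣ) : k)) := by
  have hs := isSplit_oddForm (l := l) h2
  have hc := hasCoords_oddForm (l := l) (k := k)
  have hX : ∀ i, g oz (op i) = 0 := fun i => (hXE i i.2).1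
  have hE : ∀ i, g (op i) oz = 0 := fun i => (hXE i i.2).2
  have hD := eq_diagLam_inv (hA ▸ hc.transpose_blockA_mul hs hg hC hX)
  have hA' : ∀ a b, g (op a) (op b) = if a = b then if (a : ℕ) + 1 = l then (c : k) else 1 else 0 :=
    fun a b => by
      have h := congrFun (congrFun hA a) b
      rwa [diagLam, diagonal_apply] at h
  have hC' : ∀ a b, g (on a) (op b) = 0 := fun a b => congrFun (congrFun hC a) b
  have hF : ∀ i, g (on i) oz = 0 := by
    intro i
    have h := hc.apply_eq hg (op i) oz
    simp only [col_apply, hX, mul_zero, zero_mul, zero_add, hC', hA', hE, add_zero, ite_mul,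
      Finset.sum_ite_eq', Finset.mem_univ, if_true] at h
    rw [isMiddle_oddForm.apply_self, if_neg ((isMiddle_oddForm (k := k)).ne_pos i).symm] at h
    rw [← ite_mul] at h
    exact (mul_eq_zero.mp h).resolve_left (diagLam_ne_zero c i)
  have hzz : g oz oz ≠ 0 := by
    intro h0
    have h := hc.apply_eq hg oz oz
    simp only [col_apply, h0, hE, hF, mul_zero, add_zero, Finset.sum_const_zero] at h
    rw [isMiddle_oddForm.apply_self, if_pos rfl] at h
    exact h2 h.symm
  have hY : ∀ i, g oz (on i) = 0 := by
    intro i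
    have h := hc.apply_eq hg oz (on i)
    simp only [col_apply, hE, hF, zero_mul, add_zero, Finset.sum_const_zero] at h
    rw [hs.apply_neg, if_neg ((isMiddle_oddForm (k := k)).ne_pos i)] at h
    exact (mul_eq_zero.mp h).resolve_left (mul_ne_zero h2 hzz)
  refine ⟨g oz oz, of fun i j => g (op i) (on j), ?_⟩
  ext a b
  rcases a with a | a | a <;> rcases b with b | b | b
  · simp [oddBlock, oz]
  · exact hX b
  · exact hY b
  · exact hE a
  · exact congrFun (congrFun hA a) b
  · rfl
  · exact hF a
  · exact hC' a b
  · exact congrFun (congrFun hD a) b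

theorem oddStep5_of_eq (h2 : (2 : k) ≠ 0) {g : Matrix (OddIdx l) (OddIdx l) k}
    (hg : Preserves (oddForm l k) g) {a : k} {c : kˣ} {B : Matrix (Fin l) (Fin l) k}
    (hB : g = oddBlock a (diagLam l (c : k)) B (diagLam l ((c⁻¹ : kˣ) : k))) :
    OddStep5 g c := by
  obtain ⟨h, hops, hrow, hcol, hzero⟩ := hasCoords_oddForm.swap.exists_ops_clear_blockC
    (isSplit_oddForm h2).swap hg (d := fun i => if (i : ℕ) + 1 = l then ((c⁻¹ : kˣ) : k) else 1)
    (by rw [hB]; rfl) fun _ _ => by rw [hB]; rfl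
  have : h = oddDiag l a c := by
    ext i j
    rcases i with i | i | i
    · rw [hrow (Sum.inl i) (by simp [op]), hB]
      rfl
    · rcases j with j | j | j
      · refine (hcol (Sum.inl j) (fun i => by rw [hB]; rfl) i).trans ?_
        rw [hB]; rfl
      · refine (hcol (Sum.inr (Sum.inl j)) (fun i => by rw [hB]; rfl) i).trans ?_
        rw [hB]; rfl
      · exact hzero i j (diagLam_ne_zero _ _) (diagLam_ne_zero _ _)
    · rw [hrow (Sum.inr (Sum.inr i)) (by simp [op]), hB]
      rfl
  rw [OddStep5]
  exact ⟨a, this ▸ hops⟩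

theorem XEZero.of_rows_eq {m : ℕ} {g h : Matrix (OddIdx l) (OddIdx l) k}
    (hrow : ∀ a, (∀ i, a ≠ on i) → h a = g a) (hg : XEZero m g) : XEZero m h := by
  intro i hi
  rw [hrow oz (by simp [oz, on]), hrow (op i) (by simp [op, on])]
  exact hg i hi

theorem exists_oddOutputs (h2 : (2 : k) ≠ 0) (hl : 1 ≤ l)
    (g : orthGroup (oddForm l k)) : ∃ c : kˣ, OddOutputs (toMat g) c := by
  have hs := isSplit_oddForm (l := l) h2
  have hc := hasCoords_oddForm (l := l) (k := k)
  have hz := isMiddle_oddForm (l := l) (k := k)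
  have hE1 : ∀ x ∈ E1 k op on, HasSpinorNorm (oddForm l k) x 1 :=
    fun _ => hs.hasSpinorNorm_of_mem_E1
  have hE3 : ∀ x ∈ E3 k op on, HasSpinorNorm (oddForm l k) x 1 :=
    fun _ => hs.hasSpinorNorm_of_mem_E3
  have hE4 : ∀ x ∈ E4 k oz op on, HasSpinorNorm (oddForm l k) x 1 :=
    fun _ => hs.hasSpinorNorm_of_mem_E4 hz
  obtain ⟨g₁, hops₁, hform⟩ := hs.exists_ops_blockA_normal hl (toMat g)
  have hg₁ := Preserves.of_ops hs hE1 hE1 hops₁ (preserves_toMat g)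
  suffices h : ∃ g₂ g₃ g₄, OddStep2 g₁ g₂ ∧ OddStep3 g₂ g₃ ∧ OddStep4 g₃ g₄ ∧
      Preserves (oddForm l k) g₄ by
    obtain ⟨g₂, g₃, g₄, hstep₂, hstep₃, hstep₄, hg₄⟩ := h
    obtain ⟨-, a, c, B, hB⟩ := id hstep₄
    exact ⟨c, g₁, g₂, g₃, g₄, ⟨hops₁, hform⟩, hstep₂, hstep₃, hstep₄, oddStep5_of_eq h2 hg₄ hB⟩
  rcases hform with ⟨c, hA⟩ | ⟨m, hm, hA⟩
  · obtain ⟨g₂, hops₂, hA₂, hXE₂⟩ := hs.exists_ops_clear hz hA Finset.univ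
      fun i _ => diagLam_ne_zero c i
    have hg₂ := Preserves.of_ops hs hE4 hE4 hops₂ hg₁
    have hXE₂' : XEZero l g₂ := fun i _ => hXE₂ i (Finset.mem_univ i)
    obtain ⟨g₃, hops₃, hrow, -, hzero⟩ := hc.exists_ops_clear_blockC hs hg₂ hA₂
      fun i _ => (hXE₂ i (Finset.mem_univ i)).1
    have hg₃ := Preserves.of_ops hs hE3 (by simp) hops₃ hg₂
    have hA₃ : blockA op g₃ = diagLam l (c : k) := by
      rw [diagLam, ← hA₂]
      ext i j
      exact congrFun (hrow _ fun j => hs.pos_ne_neg i j) _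
    have hC₃ : blockC op on g₃ = 0 := Matrix.ext fun i j =>
      hzero i j (diagLam_ne_zero c i) (diagLam_ne_zero c j)
    have hXE₃ : XEZero l g₃ := hXE₂'.of_rows_eq hrow
    have hfull : OddFull g₃ := ⟨⟨c, hA₃⟩, hXE₃⟩
    obtain ⟨a, B, hB⟩ := exists_eq_oddBlock h2 hg₃ hA₃ hC₃ hXE₃
    exact ⟨g₂, g₃, g₃, ⟨hops₂, Or.inl ⟨⟨c, hA₂⟩, hXE₂'⟩⟩, ⟨hops₃, Or.inl ⟨hfull, hC₃⟩⟩,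
      ⟨Or.inl ⟨hfull, rfl⟩, a, c, B, hB⟩, hg₃⟩
  · obtain ⟨g₂, hops₂, hA₂, hXE₂⟩ := hs.exists_ops_clear hz hA
      (Finset.univ.filter fun i : Fin l => (i : ℕ) < m) fun i hi => by
        simp [(Finset.mem_filter.mp hi).2]
    have hg₂ := Preserves.of_ops hs hE4 hE4 hops₂ hg₁
    have hXE₂' : XEZero m g₂ := fun i hi => hXE₂ i (by simpa using hi)
    obtain ⟨g₃, hops₃, hrow, -, hzero⟩ := hc.exists_ops_clear_blockC hs hg₂ hA₂
      fun i hi => (hXE₂' i (by simpa using hi)).1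
    have hg₃ := Preserves.of_ops hs hE3 (by simp) hops₃ hg₂
    have hA₃ : blockA op g₃ = diagRank k l m := by
      rw [diagRank, ← hA₂]
      ext i j
      exact congrFun (hrow _ fun j => hs.pos_ne_neg i j) _
    have hC₃ : ∀ i j : Fin l, (i : ℕ) < m → (j : ℕ) < m → blockC op on g₃ i j = 0 :=
      fun i j hi hj => hzero i j (by simp [hi]) (by simp [hj])
    have hXE₃ : XEZero m g₃ := hXE₂'.of_rows_eq hrow
    have hpart : OddPartial m g₃ := ⟨hm, hA₃, hXE₃⟩
    have hint := hs.isInterchange_wMat_sub hz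
    obtain ⟨hX₃, hCw⟩ := hc.interchange hs hg₃ hA₃ (fun i hi => (hXE₃ i hi).1) hC₃ hint
    have hw : Preserves (oddForm l k) (oddSwap k l m * g₃) :=
      (hasSpinorNorm_oddSwap h2 m).preserves.mul hg₃
    have hXw : ∀ i, (oddSwap k l m * g₃) oz (op i) = 0 := by
      obtain ⟨-, -, hother⟩ := hint.list_prod
        ((List.nodup_finRange l).filter fun i : Fin l => decide (m ≤ (i : ℕ))) g₃
      obtain ⟨r, hr⟩ := hother oz hz.ne_pos hz.ne_neg
      intro i
      rw [oddSwap, hr]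
      exact (congrArg (r * ·) (hX₃ i)).trans (mul_zero r)
    have hdet : (blockA op (oddSwap k l m * g₃)).det ≠ 0 := by
      have := congrArg det (hc.transpose_blockA_mul hs hw hCw hXw)
      rw [det_mul, det_transpose, det_one] at this
      exact left_ne_zero_of_mul_eq_one this
    obtain ⟨c, h, hops, hAh, hkeep⟩ := hs.exists_ops_blockA_eq_diagLam hl hdet
    have hh := Preserves.of_ops hs hE1 hE1 hops hw
    -- Only the column `E` needs clearing: `X` was already zero before the interchange, and neither
    -- the interchange nor type 1 operations disturb this.
    obtain ⟨g₄, hops₄, hcol, hE₄⟩ := hs.exists_ops_clear_col hz hAh Finset.univ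
      fun i _ => diagLam_ne_zero c i
    have hg₄ := Preserves.of_ops hs hE4 hE4 hops₄ hh
    have hA₄ : blockA op g₄ = diagLam l (c : k) := by
      rw [← hAh]; ext i j; exact hcol _ _
    have hC₄ : blockC op on g₄ = 0 := by
      rw [← hkeep.1 hCw]; ext i j; exact hcol _ _
    obtain ⟨a, B, hB⟩ := exists_eq_oddBlock h2 hg₄ hA₄ hC₄ fun i _ =>
      ⟨(hcol _ _).trans (hkeep.2 oz hz.ne_pos hz.ne_neg hXw i), hE₄ i (Finset.mem_univ i)⟩
    exact ⟨g₂, g₃, g₄, ⟨hops₂, Or.inr ⟨m, hm, hA₂, hXE₂'⟩⟩, ⟨hops₃, Or.inr ⟨m, hpart, hC₃⟩⟩,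
      ⟨Or.inr ⟨m, hpart, h, hops, hops₄⟩, a, c, B, hB⟩, hg₄⟩

theorem OddOutputs.hasSpinorNorm (h2 : (2 : k) ≠ 0) {g : Matrix (OddIdx l) (OddIdx l) k}
    {c : kˣ} {x : SqClass k} (hg : HasSpinorNorm (oddForm l k) g x) (h : OddOutputs g c) :
    ∃ a, HasSpinorNorm (oddForm l k) (oddDiag l a c) x := by
  have hs := isSplit_oddForm (l := l) h2
  have hE1 : ∀ x ∈ E1 k op on, HasSpinorNorm (oddForm l k) x 1 :=
    fun _ => hs.hasSpinorNorm_of_mem_E1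
  have hE2 : ∀ x ∈ E2 k op on, HasSpinorNorm (oddForm l k) x 1 :=
    fun _ => hs.hasSpinorNorm_of_mem_E2
  have hE3 : ∀ x ∈ E3 k op on, HasSpinorNorm (oddForm l k) x 1 :=
    fun _ => hs.hasSpinorNorm_of_mem_E3
  have hE4 : ∀ x ∈ E4 k oz op on, HasSpinorNorm (oddForm l k) x 1 :=
    fun _ => hs.hasSpinorNorm_of_mem_E4 isMiddle_oddForm
  have hstep := @HasSpinorNorm.of_ops _ k _ _ _ _ h2 hs.symm hs.isUnit_det
  obtain ⟨g₁, g₂, g₃, g₄, ⟨h₁, -⟩, ⟨h₂, -⟩, ⟨h₃, -⟩, ⟨h₄, -⟩, a, h₅⟩ := h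
  have hg₃ := hstep hE3 (by simp) h₃ (hstep hE4 hE4 h₂ (hstep hE1 hE1 h₁ hg))
  refine ⟨a, hstep hE2 (by simp) h₅ ?_⟩
  rcases h₄ with ⟨-, rfl⟩ | ⟨m, -, h, h₄, h₄'⟩
  · exact hg₃
  · refine hstep hE4 hE4 h₄' (hstep hE1 hE1 h₄ ?_)
    simpa using (hasSpinorNorm_oddSwap h2 m).mul h2 hs.symm hs.isUnit_det hg₃

theorem OddReduces.hasSpinorNorm (h2 : (2 : k) ≠ 0) {g : Matrix (OddIdx l) (OddIdx l) k}
    {c : kˣ} {x : SqClass k} (hg : HasSpinorNorm (oddForm l k) g x) (h : OddReduces g c) :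
    ∃ a, HasSpinorNorm (oddForm l k) (oddDiag l a c) x := by
  have hs := isSplit_oddForm (l := l) h2
  have hE : ∀ x ∈ OddElem l k, HasSpinorNorm (oddForm l k) x 1 := by
    rintro x ((((hx | hx) | hx) | hx) | ⟨i, -, rfl⟩)
    exacts [hs.hasSpinorNorm_of_mem_E1 hx, hs.hasSpinorNorm_of_mem_E2 hx,
      hs.hasSpinorNorm_of_mem_E3 hx, hs.hasSpinorNorm_of_mem_E4 isMiddle_oddForm hx,
      hs.hasSpinorNorm_wMat i]
  obtain ⟨a, h⟩ := h
  exact ⟨a, HasSpinorNorm.of_ops h2 hs.symm hs.isUnit_det hE hE h hg⟩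

end Outputs

end

end SplitOrth

/-! ### The main theorem -/

open SplitOrth

theorem corollaryA1 {k : Type*} [Field k] (hk : ringChar k ≠ 2) (l : ℕ) (hl : 1 ≤ l) :
    -- even dimension `2l`
    (∀ g : SplitOrth.orthGroup (SplitOrth.evenForm l k),
      -- the spinor norm is well defined
      ((∃ us, SplitOrth.IsProdOfReflections (SplitOrth.evenForm l k) g us) ∧
        ∀ us, SplitOrth.IsProdOfReflections (SplitOrth.evenForm l k) g us →
          ∀ a : kˣ, (a : k) = (us.map fun u => SplitOrth.bil (SplitOrth.evenForm l k) u u / 2).prod →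
            SplitOrth.spinorNorm (SplitOrth.evenForm l k) g = SplitOrth.sqClass a) ∧
      -- the algorithm can be carried out on `g`
      (∃ lam : kˣ, SplitOrth.EvenOutputs (SplitOrth.toMat g) lam) ∧
      -- every entry that it produces represents the spinor norm
      (∀ lam : kˣ, SplitOrth.EvenOutputs (SplitOrth.toMat g) lam ∨
          SplitOrth.EvenReduces (SplitOrth.toMat g) lam →
        SplitOrth.spinorNorm (SplitOrth.evenForm l k) g = SplitOrth.sqClass lam ∧
        ((SplitOrth.toMat g).det = 1 →
          (g ∈ commutator (SplitOrth.orthGroup (SplitOrth.evenForm l k)) ↔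
            IsSquare (lam : k))))) ∧
    -- odd dimension `2l + 1`
    (∀ g : SplitOrth.orthGroup (SplitOrth.oddForm l k),
      ((∃ us, SplitOrth.IsProdOfReflections (SplitOrth.oddForm l k) g us) ∧
        ∀ us, SplitOrth.IsProdOfReflections (SplitOrth.oddForm l k) g us →
          ∀ a : kˣ, (a : k) = (us.map fun u => SplitOrth.bil (SplitOrth.oddForm l k) u u / 2).prod →
            SplitOrth.spinorNorm (SplitOrth.oddForm l k) g = SplitOrth.sqClass a) ∧
      (∃ lam : kˣ, SplitOrth.OddOutputs (SplitOrth.toMat g) lam) ∧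
      (∀ lam : kˣ, SplitOrth.OddOutputs (SplitOrth.toMat g) lam ∨
          SplitOrth.OddReduces (SplitOrth.toMat g) lam →
        SplitOrth.spinorNorm (SplitOrth.oddForm l k) g = SplitOrth.sqClass lam ∧
        ((SplitOrth.toMat g).det = 1 →
          (g ∈ commutator (SplitOrth.orthGroup (SplitOrth.oddForm l k)) ↔
            IsSquare (lam : k))))) := by
  have h2 : (2 : k) ≠ 0 := Ring.two_ne_zero hk
  refine ⟨fun g => ?_, fun g => ?_⟩
  · have hs := isSplit_evenForm (l := l) h2
    refine ⟨⟨exists_isProdOfReflections h2 hs.symm hs.isUnit_det g, fun us hus a ha =>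
      spinorNorm_eq h2 hs.symm hs.isUnit_det hus ha⟩, exists_evenOutputs h2 hl g, fun c hc => ?_⟩
    have hg : HasSpinorNorm (evenForm l k) (toMat g) (spinorNorm _ g) := ⟨g, rfl, rfl⟩
    have hsp : spinorNorm _ g = sqClass c := by
      have h : HasSpinorNorm (evenForm l k) (evenDiag l c) (spinorNorm _ g) :=
        hc.elim (fun h => h.hasSpinorNorm h2 hg) fun h => h.hasSpinorNorm h2 hg
      exact h.unique (hasSpinorNorm_evenDiag h2 hl c)
    exact ⟨hsp, fun hdet => by rw [hs.mem_commutator_iff ⟨0, hl⟩ hdet, hsp, sqClass_eq_one]⟩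
  · have hs := isSplit_oddForm (l := l) h2
    refine ⟨⟨exists_isProdOfReflections h2 hs.symm hs.isUnit_det g, fun us hus a ha =>
      spinorNorm_eq h2 hs.symm hs.isUnit_det hus ha⟩, exists_oddOutputs h2 hl g, fun c hc => ?_⟩
    have hg : HasSpinorNorm (oddForm l k) (toMat g) (spinorNorm _ g) := ⟨g, rfl, rfl⟩
    have hsp : spinorNorm _ g = sqClass c := by
      obtain ⟨a, h⟩ : ∃ a, HasSpinorNorm (oddForm l k) (oddDiag l a c) (spinorNorm _ g) :=
        hc.elim (fun h => h.hasSpinorNorm h2 hg) fun h => h.hasSpinorNorm h2 hg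
      -- Orthogonality of the final matrix, inherited from `g`, is what restricts the unspecified
      -- `α` to `±1`.
      exact h.unique (hasSpinorNorm_oddDiag h2 hl h.preserves)
    exact ⟨hsp, fun hdet => by rw [hs.mem_commutator_iff ⟨0, hl⟩ hdet, hsp, sqClass_eq_one]⟩
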